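/- There is a universal constant $C>0$ such that the following holds. Let $M\in\mathbb{R}^{p\times n}$ be a matrix of rank $k$ with singular value decomposition $M=\sum_{j=1}^k\sigma_j u_jv_j^T$, where $\sigma_1\ge\dots\ge\sigma_k>0$, and put $\sigma_0=+\infty$, $\sigma_{k+1}=0$. Let $E\in\mathbb{R}^{p\times n}$ be a random matrix with i.i.d. $\mathcal N(0,1)$ entries, let $\hat M=M+E$, and let $\hat M=\sum_{j=1}^{\min(p,n)}\hat\sigma_j\hat u_j\hat v_j^T$ be a singular value decomposition (with the $\hat v_j$ random vectors), where $\hat\sigma_1\ge\hat\sigma_2\ge\dots\ge\hat\sigma_{\min(p,n)}\ge 0$. For $1\le a\le b\le k$ let $V_{a:b}=(v_a,\dots,v_b)$, $\hat V_{a:b}=(\hat v_a,\dots,\hat v_b)$, $V=(v_1,\dots,v_k)$, let $$g_{a:b}=\min\{\sigma_{a-1}-\sigma_a,\ \sigma_b-\sigma_{b+1}\},$$ and define $$S_{a:b}=(I-VV^T)\big(\hat V_{a:b}\hat V_{a:b}^T-V_{a:b}V_{a:b}^T\big)V_{a:b}-\sum_{a\le j\le b}\frac1{\sigma_j}(I-VV^T)E^Tu_jv_j^TV_{a:b}.$$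 Suppose that $\mathbb{E}\|E\|\le g_{a:b}/8$, where $\|\cdot\|$ is the operator norm. Then $S_{a:b}$ is integrable, and for every fixed $W\in\mathbb{R}^{n\times(b-a+1)}$ and every $t\ge\log 4$, with probability at least $1-2e^{-t}$, $$\big|\langle S_{a:b}-\mathbb{E}S_{a:b},W\rangle\big|\le C\Big(1+\frac{\sigma_a-\sigma_b}{g_{a:b}}\Big)\frac{\sqrt t}{g_{a:b}}\cdot\frac{\sqrt{n+p}+\sqrt t}{g_{a:b}}\,\|W\|_*,$$ where $\langle A,B\rangle=\sum_{i,j}A_{ij}B_{ij}$ and $\|\cdot\|_*$ is the nuclear (Schatten-1) norm. -/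

import Mathlib

open MeasureTheory ProbabilityTheory

namespace SpectralPert

/-- Operator (spectral) norm of a real matrix, with respect to the Euclidean norms. -/
noncomputable def opNorm {m n : Type*} [Fintype m] [Fintype n] [DecidableEq n]
    (A : Matrix m n ℝ) : ℝ :=
  ‖LinearMap.toContinuousLinearMap (Matrix.toEuclideanLin A)‖

/-- Nuclear (Schatten-1) norm of a real matrix: the sum of its singular values. -/
noncomputable def nuclearNorm {m n : Type*} [Fintype m] [Fintype n] [DecidableEq n]
    (A : Matrix m n ℝ) : ℝ :=
  ∑ i ∈ Finset.range (Fintype.card n), (Matrix.toEuclideanLin A).singularValues i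

/-- The trace inner product `⟨A, B⟩ = ∑ i j, A i j * B i j` of two real matrices. -/
def matInner {m n : Type*} [Fintype m] [Fintype n] (A B : Matrix m n ℝ) : ℝ :=
  ∑ i, ∑ j, A i j * B i j

/-- `A = ∑ j, σ j • u j (v j)ᵀ` is a singular value decomposition with `r` terms: the `u j` are
orthonormal, the `v j` are orthonormal, and the `σ j` are nonnegative and listed in nonincreasing
order. All indices start from `0`. -/
structure IsSVD {p n r : ℕ} (A : Matrix (Fin p) (Fin n) ℝ) (σ : Fin r → ℝ)
    (u : Fin r → EuclideanSpace ℝ (Fin p)) (v : Fin r → EuclideanSpace ℝ (Fin n)) : Prop where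
  orthonormal_left : Orthonormal ℝ u
  orthonormal_right : Orthonormal ℝ v
  nonneg : ∀ j, 0 ≤ σ j
  antitone : Antitone σ
  eq_sum : A = ∑ j, σ j • Matrix.vecMulVec (u j) (v j)

/-- The matrix whose columns are all the vectors `v j`. -/
def colMatrix {n r : ℕ} (v : Fin r → EuclideanSpace ℝ (Fin n)) : Matrix (Fin n) (Fin r) ℝ :=
  Matrix.of fun i j => v j i

/-- The indices in `Fin r` between `a` and `b`, both included. -/
abbrev Block (r a b : ℕ) : Type := {j : Fin r // a ≤ (j : ℕ) ∧ (j : ℕ) ≤ b}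

/-- The matrix whose columns are the vectors `v a, …, v b`. -/
def blockMatrix {n r : ℕ} (v : Fin r → EuclideanSpace ℝ (Fin n)) (a b : ℕ) :
    Matrix (Fin n) (Block r a b) ℝ :=
  Matrix.of fun i j => v j.1 i

/-- The gap below the block ending at `b`, where a value `0` is appended after the last one. -/
def lowerGap {k : ℕ} (σ : Fin k → ℝ) (b : Fin k) : ℝ :=
  σ b - (if h : (b : ℕ) + 1 < k then σ ⟨(b : ℕ) + 1, h⟩ else 0)

/-- The singular value gap of the block from `a` to `b`: the minimum of the gap above `a` and the
gap below `b`. The gap above the first singular value is `+∞`, so that the minimum is then just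
the gap below `b`. -/
noncomputable def gap {k : ℕ} (σ : Fin k → ℝ) (a b : Fin k) : ℝ :=
  if (a : ℕ) = 0 then lowerGap σ b
  else min (σ ⟨(a : ℕ) - 1, lt_of_le_of_lt (Nat.sub_le _ _) a.isLt⟩ - σ a) (lowerGap σ b)

/-- The part of `(I - V Vᵀ) (V̂_{a:b} V̂_{a:b}ᵀ - V_{a:b} V_{a:b}ᵀ) V_{a:b}` which remains after
subtracting the linear term `∑_{a ≤ j ≤ b} (1 / σ j) (I - V Vᵀ) Eᵀ u_j v_jᵀ V_{a:b}`. -/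
noncomputable def remainder {p n k r : ℕ} (σ : Fin k → ℝ)
    (u : Fin k → EuclideanSpace ℝ (Fin p)) (v : Fin k → EuclideanSpace ℝ (Fin n))
    (a b : Fin k) (E : Matrix (Fin p) (Fin n) ℝ) (v' : Fin r → EuclideanSpace ℝ (Fin n)) :
    Matrix (Fin n) (Block k a b) ℝ :=
  (1 - colMatrix v * (colMatrix v).transpose)
      * (blockMatrix v' a b * (blockMatrix v' a b).transpose
          - blockMatrix v a b * (blockMatrix v a b).transpose)
      * blockMatrix v a b
    - ∑ j : Block k a b, (1 / σ j.1) •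
        ((1 - colMatrix v * (colMatrix v).transpose) * E.transpose
          * Matrix.vecMulVec (u j.1) (v j.1) * blockMatrix v a b)

end SpectralPert

/-! The remainder is a Lipschitz function of the Gaussian matrix `E` as long as `opNorm E` is small
compared with the gap `g`, so Gaussian concentration applies to its linear forms.

The Lipschitz bound comes from contour integration. The Hermitian dilation of `M` has eigenvalues
among `0` and `±σ j`, and the circle centred at `(σ a + σ b) / 2` with radius `R = (σ a - σ b + g) /
2` encloses exactly the block `a, …, b`, with margin `g / 2`. By Weyl's inequality a perturbation
with `opNorm E ≤ g / 4` keeps a margin `g / 4`, so the block projection of `M + E` is an integral of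
the perturbed resolvent over this fixed circle. Tested against `(I - V Vᵀ) x` and a vector in the
span of the block, the first order term of the resolvent expansion integrates to the linear term
subtracted in `remainder`. The second order terms of two perturbations `E`, `F` of norm at most `δ`
differ by `O(δ * opNorm (E - F) / g ^ 3)`, and multiplying by the length of the circle gives the
Lipschitz constant of `opNorm_remainder_sub_le`, of order `(1 + (σ a - σ b) / g) * δ / g ^ 2`.

For a level `s`, take `δ = 𝔼 opNorm E + 5 √s`, which is exceeded with probability at most `exp (-5
s)`. If `5 √s ≤ g / 8`, then `δ ≤ g / 4`; the linear form is extended from the good event to a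
globally Lipschitz function of `E` and concentrates around the mean of the extension. If `√s` is
larger, the target bound already exceeds a crude bound for the remainder
(`exists_centre_remainder`). The centre obtained this way depends on `s`, and
`concentration_around_mean` replaces it by the true mean. Duality of operator and nuclear norm
passes from matrices to linear forms, and a net argument gives `𝔼 opNorm E ≤ 12 √(n + p)`. -/

namespace SpectralPert

/-! ### Gaussian concentration for Lipschitz functions (Maurey–Pisier rotation argument) -/

section Concentration

open scoped NNReal ENNReal Convolution

/-- The quarter circle `cos θ • x + sin θ • y` leads from `x` to `y`, and its position and velocity
form the rotated pair. So `f y - f x` is the integral of the derivative along it, and Jensen's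
inequality for `exp` is applied to the uniform law on `(0, π / 2]`. -/
lemma exp_sub_le_lintegral_rotation {F : Type*} [NormedAddCommGroup F]
    [InnerProductSpace ℝ F] {f : F → ℝ} (hf : ContDiff ℝ 1 f) (x y : F) :
    ENNReal.ofReal (Real.exp (f y - f x)) ≤ ENNReal.ofReal (2 / Real.pi) *
      ∫⁻ θ in Set.Ioc 0 (Real.pi / 2), ENNReal.ofReal (Real.exp (Real.pi / 2 *
        fderiv ℝ f (ContinuousLinearMap.rotation θ (x, y)).1
          (ContinuousLinearMap.rotation θ (x, y)).2)) := by
  set φ : ℝ → ℝ := fun θ => fderiv ℝ f (ContinuousLinearMap.rotation θ (x, y)).1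
          (ContinuousLinearMap.rotation θ (x, y)).2 with hφ
  have hcont : Continuous φ := by
    simp only [hφ, ContinuousLinearMap.rotation_apply]
    have := hf.continuous_fderiv (by norm_num)
    fun_prop
  have hpi := Real.pi_pos
  have hderiv : ∀ θ, HasDerivAt (fun θ => f (Real.cos θ • x + Real.sin θ • y)) (φ θ) θ := by
    intro θ
    have h1 : HasDerivAt (fun θ => Real.cos θ • x + Real.sin θ • y)
        (-Real.sin θ • x + Real.cos θ • y) θ :=
      ((Real.hasDerivAt_cos θ).smul_const x).add ((Real.hasDerivAt_sin θ).smul_const y)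
    have h2 := ((hf.differentiable (by norm_num)) (Real.cos θ • x + Real.sin θ • y)).hasFDerivAt
    have := h2.comp_hasDerivAt θ h1
    simp only [map_add, map_smul, Function.comp_def] at this
    simpa [hφ, ContinuousLinearMap.rotation_apply] using this
  have hFTC : ∫ θ in (0 : ℝ)..(Real.pi / 2), φ θ = f y - f x := by
    rw [intervalIntegral.integral_eq_sub_of_hasDerivAt (fun θ _ => hderiv θ)
      (hcont.intervalIntegrable _ _)]
    simp
  rw [intervalIntegral.integral_of_le (by positivity)] at hFTC
  have hvol : volume.real (Set.Ioc 0 (Real.pi / 2)) = Real.pi / 2 := by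
    simp [Measure.real, (by positivity : 0 ≤ Real.pi / 2)]
  have hJ := convexOn_exp.map_set_average_le (μ := volume) (t := Set.Ioc 0 (Real.pi / 2))
    (f := fun θ => Real.pi / 2 * φ θ) Real.continuous_exp.continuousOn isClosed_univ
    (by simp [hpi]) (by simp) (by simp)
    ((by fun_prop : Continuous fun θ => Real.pi / 2 * φ θ).integrableOn_Ioc)
    ((by fun_prop : Continuous (Real.exp ∘ fun θ => Real.pi / 2 * φ θ)).integrableOn_Ioc)
  rw [setAverage_eq, setAverage_eq, hvol, integral_const_mul, hFTC] at hJ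
  have hint : IntegrableOn (fun θ => Real.exp (Real.pi / 2 * φ θ)) (Set.Ioc 0 (Real.pi / 2)) :=
    (by fun_prop : Continuous (fun θ => Real.exp (Real.pi / 2 * φ θ))).integrableOn_Ioc
  rw [← ofReal_integral_eq_lintegral_ofReal hint
    (Filter.Eventually.of_forall fun _ => by positivity), ← ENNReal.ofReal_mul (by positivity)]
  apply ENNReal.ofReal_le_ofReal
  convert hJ using 1
  · congr 1
    simp only [smul_eq_mul]
    field_simp
  · simp only [smul_eq_mul, inv_div]

variable {F : Type*} [NormedAddCommGroup F] [InnerProductSpace ℝ F] [FiniteDimensional ℝ F]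
  [MeasurableSpace F] [BorelSpace F]

lemma lintegral_exp_dual_stdGaussian (ℓ : F →L[ℝ] ℝ) :
    ∫⁻ y, ENNReal.ofReal (Real.exp (ℓ y)) ∂(stdGaussian F)
      = ENNReal.ofReal (Real.exp (‖ℓ‖ ^ 2 / 2)) := by
  have hmap : (stdGaussian F).map ℓ = gaussianReal 0 (‖ℓ‖ ^ 2).toNNReal := by
    rw [IsGaussian.map_eq_gaussianReal ℓ]
    have h1 : (stdGaussian F)[ℓ] = 0 := integral_strongDual_stdGaussian ℓ
    rw [h1, variance_dual_stdGaussian]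
  have hm := mgf_gaussianReal hmap 1
  have hint : Integrable (fun y => Real.exp (ℓ y)) (stdGaussian F) := by
    have := integrable_exp_mul_gaussianReal (μ := 0) (v := (‖ℓ‖ ^ 2).toNNReal) 1
    rw [← hmap, integrable_map_measure (by fun_prop) (by fun_prop)] at this
    simpa [Function.comp_def] using this
  rw [← ofReal_integral_eq_lintegral_ofReal hint (Filter.Eventually.of_forall fun _ => by positivity)]
  congr 1
  simpa [mgf, Real.coe_toNNReal _ (sq_nonneg ‖ℓ‖)] using hm

lemma map_rotation_stdGaussian (θ : ℝ) :
    ((stdGaussian F).prod (stdGaussian F)).map (ContinuousLinearMap.rotation θ)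
      = (stdGaussian F).prod (stdGaussian F) :=
  IsGaussian.map_rotation_eq_self_of_forall_strongDual_eq_zero
    (fun ℓ => integral_strongDual_stdGaussian ℓ) θ

/-- A pair of independent standard Gaussians is invariant under rotation, so after Tonelli every `θ`
contributes the same integral. In it position and velocity are independent: for a fixed position the
velocity integral is the Laplace transform of a Gaussian linear form. -/
lemma lintegral_exp_sub_le_of_contDiff {f : F → ℝ} (hf : ContDiff ℝ 1 f) {K : ℝ}
    (hK : ∀ x, ‖fderiv ℝ f x‖ ≤ K) :
    ∫⁻ p, ENNReal.ofReal (Real.exp (f p.2 - f p.1)) ∂((stdGaussian F).prod (stdGaussian F))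
      ≤ ENNReal.ofReal (Real.exp (5 / 4 * K ^ 2)) := by
  have hpi := Real.pi_pos
  have hfd := hf.continuous_fderiv (by norm_num)
  set G : F × F → ℝ≥0∞ := fun q => ENNReal.ofReal (Real.exp (Real.pi / 2 * fderiv ℝ f q.1 q.2))
    with hG
  have hGm : Measurable G := by
    apply Continuous.measurable
    exact ENNReal.continuous_ofReal.comp (by fun_prop)
  have hGint : ∫⁻ q, G q ∂((stdGaussian F).prod (stdGaussian F))
      ≤ ENNReal.ofReal (Real.exp (5 / 4 * K ^ 2)) := by
    rw [lintegral_prod _ hGm.aemeasurable]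
    calc _ ≤ ∫⁻ _, ENNReal.ofReal (Real.exp (5 / 4 * K ^ 2)) ∂(stdGaussian F) := by
          apply lintegral_mono
          intro x
          have := lintegral_exp_dual_stdGaussian ((Real.pi / 2) • fderiv ℝ f x)
          simp only [smul_apply, smul_eq_mul] at this
          simp only [hG]
          rw [this]
          apply ENNReal.ofReal_le_ofReal
          apply Real.exp_le_exp.2
          rw [norm_smul, Real.norm_of_nonneg (by positivity)]
          -- The exponent is `(π / 2) ^ 2 / 2 * ‖f'‖ ^ 2`, and `π ^ 2 ≤ 10` turns `π ^ 2 / 8` into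
          -- `5 / 4`.
          have h1 : Real.pi ^ 2 ≤ 10 := by nlinarith [Real.pi_lt_d2, Real.pi_gt_three]
          have h2 : ‖fderiv ℝ f x‖ ^ 2 ≤ K ^ 2 := by
            have := hK x
            gcongr
          nlinarith [sq_nonneg ‖fderiv ℝ f x‖]
      _ = _ := by simp
  calc _ ≤ ∫⁻ p, ENNReal.ofReal (2 / Real.pi) *
      (∫⁻ θ : ℝ in Set.Ioc 0 (Real.pi / 2), G (ContinuousLinearMap.rotation θ p))
        ∂((stdGaussian F).prod (stdGaussian F)) := by
        apply lintegral_mono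
        rintro ⟨x, y⟩
        exact exp_sub_le_lintegral_rotation hf x y
    _ = ENNReal.ofReal (2 / Real.pi) * ∫⁻ θ : ℝ in Set.Ioc 0 (Real.pi / 2),
        ∫⁻ p, G (ContinuousLinearMap.rotation θ p)
        ∂((stdGaussian F).prod (stdGaussian F)) := by
        have hm : Measurable (Function.uncurry fun (p : F × F) (θ : ℝ) =>
            G (ContinuousLinearMap.rotation θ p)) := by
          apply hGm.comp (Continuous.measurable _)
          simp only [ContinuousLinearMap.rotation_apply]
          fun_prop
        rw [lintegral_const_mul, lintegral_lintegral_swap hm.aemeasurable]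
        exact hm.lintegral_prod_right'
    _ = ENNReal.ofReal (2 / Real.pi) * ∫⁻ θ : ℝ in Set.Ioc 0 (Real.pi / 2),
        ∫⁻ p, G p ∂((stdGaussian F).prod (stdGaussian F)) := by
        congr 2 with θ
        rw [← lintegral_map hGm (ContinuousLinearMap.continuous _).measurable,
          map_rotation_stdGaussian]
    _ = ∫⁻ p, G p ∂((stdGaussian F).prod (stdGaussian F)) := by
        rw [setLIntegral_const, Real.volume_Ioc, sub_zero, mul_comm (∫⁻ p, G p ∂_), ← mul_assoc,
          ← ENNReal.ofReal_mul (by positivity)]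
        have : 2 / Real.pi * (Real.pi / 2) = 1 := by field_simp
        rw [this]; simp
    _ ≤ _ := hGint

/-- Mollification by a normalised bump of radius `ε`: averaging translates of `f` preserves the
Lipschitz constant and moves values by at most `K * ε`. -/
lemma exists_contDiff_approx {f : F → ℝ} {K : ℝ≥0} (hf : LipschitzWith K f) {ε : ℝ} (hε : 0 < ε) :
    ∃ g : F → ℝ, ContDiff ℝ 1 g ∧ (∀ x, ‖fderiv ℝ g x‖ ≤ K) ∧ ∀ x, |g x - f x| ≤ K * ε := by
  let φ : ContDiffBump (0 : F) := ⟨ε / 2, ε, by positivity, by linarith⟩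
  have hcont := hf.continuous
  have hcs : HasCompactSupport (φ.normed volume) := φ.hasCompactSupport_normed
  have hφc : Continuous (φ.normed (volume : Measure F)) := φ.continuous_normed
  let g : F → ℝ := (φ.normed volume ⋆[ContinuousLinearMap.lsmul ℝ ℝ, volume] f)
  have hint : ∀ x, Integrable (fun t => φ.normed volume t * f (x - t)) (volume : Measure F) := by
    intro x
    apply Continuous.integrable_of_hasCompactSupport (by fun_prop)
    exact hcs.mul_right
  have hLip : LipschitzWith K g := by
    apply LipschitzWith.of_dist_le_mul
    intro x y
    simp only [g, convolution_def, ContinuousLinearMap.lsmul_apply, smul_eq_mul]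
    rw [dist_eq_norm, ← integral_sub (hint x) (hint y)]
    calc _ ≤ ∫ t, φ.normed (volume : Measure F) t * (K * dist x y) := by
          apply norm_integral_le_of_norm_le
          · exact (φ.integrable_normed).mul_const _
          · refine Filter.Eventually.of_forall fun t => ?_
            rw [← mul_sub, norm_mul, Real.norm_of_nonneg (φ.nonneg_normed t)]
            gcongr
            · exact φ.nonneg_normed t
            · have := hf.dist_le_mul (x - t) (y - t)
              rwa [dist_sub_right, dist_eq_norm] at this
      _ = _ := by rw [integral_mul_const, φ.integral_normed, one_mul]
  refine ⟨g, ?_, fun x => norm_fderiv_le_of_lipschitz ℝ hLip, fun x => ?_⟩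
  · exact HasCompactSupport.contDiff_convolution_left (n := 1) _ hcs φ.contDiff_normed
      hcont.locallyIntegrable
  · have := φ.dist_normed_convolution_le (μ := volume) (g := f) (x₀ := x) (ε := K * ε)
      hcont.aestronglyMeasurable (fun y hy => (hf.dist_le_mul y x).trans (by
        have : dist y x ≤ ε := (Metric.mem_ball.1 hy).le
        gcongr))
    rwa [Real.dist_eq] at this

lemma lintegral_exp_sub_le_of_lipschitz {f : F → ℝ} {K : ℝ≥0} (hf : LipschitzWith K f) :
    ∫⁻ p, ENNReal.ofReal (Real.exp (f p.2 - f p.1)) ∂((stdGaussian F).prod (stdGaussian F))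
      ≤ ENNReal.ofReal (Real.exp (5 / 4 * K ^ 2)) := by
  have key : ∀ ε : ℝ, 0 < ε →
      ∫⁻ p, ENNReal.ofReal (Real.exp (f p.2 - f p.1)) ∂((stdGaussian F).prod (stdGaussian F))
      ≤ ENNReal.ofReal (Real.exp (2 * (K * ε) + 5 / 4 * K ^ 2)) := by
    intro ε hε
    obtain ⟨g, hg1, hg2, hg3⟩ := exists_contDiff_approx hf hε
    rw [Real.exp_add, ENNReal.ofReal_mul (by positivity)]
    refine le_trans ?_ (mul_le_mul_right (lintegral_exp_sub_le_of_contDiff hg1 hg2) _)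
    rw [← lintegral_const_mul]
    · apply lintegral_mono
      rintro ⟨x, y⟩
      simp only
      rw [← ENNReal.ofReal_mul (by positivity), ← Real.exp_add]
      apply ENNReal.ofReal_le_ofReal
      apply Real.exp_le_exp.2
      have h1 := abs_le.1 (hg3 x)
      have h2 := abs_le.1 (hg3 y)
      linarith
    · have := hg1.continuous
      exact (ENNReal.continuous_ofReal.comp (by fun_prop)).measurable
  have hlim : Filter.Tendsto (fun ε : ℝ => ENNReal.ofReal (Real.exp (2 * (K * ε) + 5 / 4 * K ^ 2)))
      (nhdsWithin 0 (Set.Ioi 0)) (nhds (ENNReal.ofReal (Real.exp (5 / 4 * K ^ 2)))) := by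
    have hc : Continuous (fun ε : ℝ => ENNReal.ofReal
        (Real.exp (2 * (K * ε) + 5 / 4 * (K : ℝ) ^ 2))) :=
      ENNReal.continuous_ofReal.comp (by fun_prop)
    have := (hc.tendsto 0).mono_left (nhdsWithin_le_nhds (s := Set.Ioi 0))
    simpa using this
  apply ge_of_tendsto hlim
  filter_upwards [self_mem_nhdsWithin] with ε hε using key ε hε

lemma integrable_of_lipschitz_stdGaussian {f : F → ℝ} {K : ℝ≥0} (hf : LipschitzWith K f) :
    Integrable f (stdGaussian F) := by
  have hid : Integrable (fun x : F => x) (stdGaussian F) := IsGaussian.integrable_id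
  refine Integrable.mono' (g := fun x => K * ‖x‖ + |f 0|) ?_
    hf.continuous.aestronglyMeasurable (Filter.Eventually.of_forall fun x => ?_)
  · exact (hid.norm.const_mul _).add (integrable_const _)
  · have := hf.dist_le_mul x 0
    rw [Real.dist_eq, dist_zero_right] at this
    rw [Real.norm_eq_abs]
    have h2 := abs_sub_abs_le_abs_sub (f x) (f 0)
    linarith

/-- Jensen's inequality in the independent copy replaces that copy by its mean. -/
lemma lintegral_exp_sub_mean_le {f : F → ℝ} {K : ℝ≥0} (hf : LipschitzWith K f) :
    ∫⁻ x, ENNReal.ofReal (Real.exp (f x - ∫ y, f y ∂(stdGaussian F))) ∂(stdGaussian F)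
      ≤ ENNReal.ofReal (Real.exp (5 / 4 * K ^ 2)) := by
  refine le_trans ?_ (lintegral_exp_sub_le_of_lipschitz hf)
  have hc := hf.continuous
  rw [lintegral_prod_symm (fun p : F × F => ENNReal.ofReal (Real.exp (f p.2 - f p.1)))
    (ENNReal.continuous_ofReal.comp (by fun_prop)).measurable.aemeasurable]
  apply lintegral_mono
  intro x
  have hi := integrable_of_lipschitz_stdGaussian hf
  by_cases hint : Integrable (fun y => Real.exp (f x - f y)) (stdGaussian F)
  · simp only
    rw [← ofReal_integral_eq_lintegral_ofReal hint
      (Filter.Eventually.of_forall fun _ => by positivity)]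
    apply ENNReal.ofReal_le_ofReal
    have := convexOn_exp.map_integral_le (μ := stdGaussian F) (f := fun y => f x - f y)
      Real.continuous_exp.continuousOn isClosed_univ (by simp)
      ((integrable_const _).sub hi) hint
    rwa [integral_sub (integrable_const _) hi, integral_const, probReal_univ, one_smul] at this
  -- Jensen needs integrability of the exponential; without it the right-hand side is infinite.
  · have : ∫⁻ y, ENNReal.ofReal (Real.exp (f x - f y)) ∂(stdGaussian F) = ⊤ := by
      by_contra h
      apply hint
      refine ⟨by apply Continuous.aestronglyMeasurable; fun_prop, ?_⟩
      rw [hasFiniteIntegral_iff_ofReal (Filter.Eventually.of_forall fun _ => by positivity)]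
      exact lt_top_iff_ne_top.2 h
    simp only [this, le_top]

/-- Gaussian concentration for Lipschitz functions, upper tail. -/
lemma stdGaussian_upper_tail {f : F → ℝ} {K : ℝ≥0} (hf : LipschitzWith K f) {s : ℝ} (hs : 0 ≤ s) :
    stdGaussian F {x | (∫ y, f y ∂(stdGaussian F)) + 5 * K * Real.sqrt s < f x}
      ≤ ENNReal.ofReal (Real.exp (-(5 * s))) := by
  set m := ∫ y, f y ∂(stdGaussian F) with hm
  -- For `K = 0` the function is constant and the strict event is empty; otherwise one may divide by
  -- `K`.
  rcases eq_or_lt_of_le (zero_le (a := K)) with hK | hK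
  · have hconst : ∀ x, f x = f 0 := by
      intro x
      have := hf.dist_le_mul x 0
      rw [← hK] at this
      simpa using this
    have : m = f 0 := by
      rw [hm, integral_congr_ae (Filter.Eventually.of_forall hconst)]
      simp
    have hempty : {x | m + 5 * (K : ℝ) * Real.sqrt s < f x} = ∅ := by
      ext x
      simp [← hK, this, hconst x]
    rw [hempty]; simp
  · have hK' : (0 : ℝ) < K := hK
    -- Chernoff parameter: the Laplace bound contributes `5 / 4 * (c * K) ^ 2 = 5 s` and the
    -- threshold `c * (5 K √s) = 10 s`, which leaves `exp (-5 s)`.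
    set c : ℝ≥0 := Real.toNNReal (2 * Real.sqrt s / K) with hcdef
    have hc : (c : ℝ) = 2 * Real.sqrt s / K := Real.coe_toNNReal _ (by positivity)
    have hcf : LipschitzWith (c * K) (fun x => (c : ℝ) * f x) := by
      apply LipschitzWith.of_dist_le_mul
      intro x y
      have := hf.dist_le_mul x y
      rw [Real.dist_eq] at this
      rw [Real.dist_eq, ← mul_sub, abs_mul, abs_of_nonneg c.coe_nonneg]
      push_cast
      rw [mul_assoc]
      gcongr
    have hM := lintegral_exp_sub_mean_le hcf
    rw [integral_const_mul, ← hm] at hM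
    have hmk := meas_ge_le_lintegral_div (μ := stdGaussian F)
      (f := fun x => ENNReal.ofReal (Real.exp ((c : ℝ) * f x - (c : ℝ) * m)))
      (ε := ENNReal.ofReal (Real.exp (10 * s)))
      (by have := hf.continuous
          exact (ENNReal.continuous_ofReal.comp (by fun_prop)).measurable.aemeasurable)
      (by simp [Real.exp_pos]) (by simp)
    refine le_trans (measure_mono ?_) (hmk.trans ?_)
    · intro x hx
      simp only [Set.mem_ofPred_eq] at hx ⊢
      apply ENNReal.ofReal_le_ofReal
      apply Real.exp_le_exp.2
      rw [← mul_sub, hc]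
      have h1 : 5 * (K : ℝ) * Real.sqrt s ≤ f x - m := by linarith
      calc 10 * s = 2 * Real.sqrt s / K * (5 * K * Real.sqrt s) := by
            field_simp
            nlinarith [Real.mul_self_sqrt hs]
        _ ≤ _ := by gcongr
    · calc _ ≤ ENNReal.ofReal (Real.exp (5 / 4 * ((c * K : ℝ≥0) : ℝ) ^ 2)) /
            ENNReal.ofReal (Real.exp (10 * s)) := by gcongr
        _ = _ := by
          rw [← ENNReal.ofReal_div_of_pos (Real.exp_pos _), ← Real.exp_sub]
          congr 2
          push_cast
          rw [hc]
          field_simp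
          nlinarith [Real.sq_sqrt hs]

end Concentration

/-! ### Operator norm of a matrix and its Gaussian expectation -/

section OperatorNorm

variable {m n : Type*} [Fintype m] [Fintype n] [DecidableEq n]

lemma opNorm_nonneg (A : Matrix m n ℝ) : 0 ≤ opNorm A := norm_nonneg _

lemma norm_toEuclideanLin_le (A : Matrix m n ℝ) (y : EuclideanSpace ℝ n) :
    ‖Matrix.toEuclideanLin A y‖ ≤ opNorm A * ‖y‖ :=
  (LinearMap.toContinuousLinearMap (Matrix.toEuclideanLin A)).le_opNorm y

lemma opNorm_le_of_inner_le {A : Matrix m n ℝ} {c : ℝ} (hc : 0 ≤ c)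
    (h : ∀ (x : EuclideanSpace ℝ m) (y : EuclideanSpace ℝ n),
      inner ℝ x (Matrix.toEuclideanLin A y) ≤ c * ‖x‖ * ‖y‖) : opNorm A ≤ c := by
  refine ContinuousLinearMap.opNorm_le_bound _ hc fun y => ?_
  simp only [LinearMap.coe_toContinuousLinearMap']
  have := h (Matrix.toEuclideanLin A y) y
  rw [real_inner_self_eq_norm_sq] at this
  rcases eq_or_lt_of_le (norm_nonneg (Matrix.toEuclideanLin A y)) with h0 | h0
  · rw [← h0]; positivity
  · nlinarith

lemma abs_inner_toEuclideanLin_le (A : Matrix m n ℝ) (x : EuclideanSpace ℝ m)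
    (y : EuclideanSpace ℝ n) :
    |inner ℝ x (Matrix.toEuclideanLin A y)| ≤ opNorm A * ‖x‖ * ‖y‖ := by
  calc _ ≤ ‖x‖ * ‖Matrix.toEuclideanLin A y‖ := abs_real_inner_le_norm _ _
    _ ≤ ‖x‖ * (opNorm A * ‖y‖) := by gcongr; exact norm_toEuclideanLin_le A y
    _ = _ := by ring

lemma inner_toEuclideanLin_eq_sum (A : Matrix m n ℝ) (x : EuclideanSpace ℝ m)
    (y : EuclideanSpace ℝ n) :
    inner ℝ x (Matrix.toEuclideanLin A y) = ∑ i, ∑ j, x i * A i j * y j := by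
  simp only [PiLp.inner_apply, Matrix.toLpLin_apply, Matrix.mulVec, dotProduct, RCLike.inner_apply,
    conj_trivial, Finset.sum_mul]
  exact Finset.sum_congr rfl fun i _ => Finset.sum_congr rfl fun j _ => by ring

lemma opNorm_add_le (A B : Matrix m n ℝ) : opNorm (A + B) ≤ opNorm A + opNorm B := by
  unfold opNorm
  rw [map_add, map_add]
  exact norm_add_le _ _

lemma opNorm_sub_comm (A B : Matrix m n ℝ) : opNorm (A - B) = opNorm (B - A) := by
  unfold opNorm
  rw [map_sub, map_sub, map_sub, map_sub]
  exact norm_sub_rev _ _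

/-- The matrix whose entries are the coordinates of a vector. -/
def vecToMatrix (x : EuclideanSpace ℝ (m × n)) : Matrix m n ℝ := Matrix.of fun i j => x (i, j)

/-- The vector `c ⊗ d`. -/
noncomputable def tensorVec (c : EuclideanSpace ℝ m) (d : EuclideanSpace ℝ n) :
    EuclideanSpace ℝ (m × n) :=
  WithLp.toLp 2 fun ij => c ij.1 * d ij.2

lemma norm_tensorVec {m n : Type*} [Fintype m] [Fintype n]
    (c : EuclideanSpace ℝ m) (d : EuclideanSpace ℝ n) :
    ‖tensorVec c d‖ = ‖c‖ * ‖d‖ := by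
  rw [EuclideanSpace.norm_eq, EuclideanSpace.norm_eq, EuclideanSpace.norm_eq, ← Real.sqrt_mul
    (by positivity), Finset.sum_mul_sum, Fintype.sum_prod_type]
  simp [tensorVec, mul_pow]

lemma inner_tensorVec (c : EuclideanSpace ℝ m) (d : EuclideanSpace ℝ n)
    (x : EuclideanSpace ℝ (m × n)) :
    inner ℝ (tensorVec c d) x = inner ℝ c (Matrix.toEuclideanLin (vecToMatrix x) d) := by
  rw [inner_toEuclideanLin_eq_sum]
  simp only [PiLp.inner_apply, tensorVec, vecToMatrix, Fintype.sum_prod_type, RCLike.inner_apply,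
    conj_trivial, Matrix.of_apply]
  exact Finset.sum_congr rfl fun i _ => Finset.sum_congr rfl fun j _ => by ring

lemma opNorm_vecToMatrix_le (x : EuclideanSpace ℝ (m × n)) : opNorm (vecToMatrix x) ≤ ‖x‖ := by
  refine opNorm_le_of_inner_le (norm_nonneg x) fun c d => ?_
  rw [← inner_tensorVec]
  calc _ ≤ ‖tensorVec c d‖ * ‖x‖ := real_inner_le_norm _ _
    _ = _ := by rw [norm_tensorVec]; ring

lemma vecToMatrix_sub {m n : Type*} (x y : EuclideanSpace ℝ (m × n)) :
    vecToMatrix (x - y) = vecToMatrix x - vecToMatrix y := rfl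

lemma lipschitzWith_opNorm_vecToMatrix :
    LipschitzWith 1 fun x : EuclideanSpace ℝ (m × n) => opNorm (vecToMatrix x) := by
  apply LipschitzWith.of_dist_le_mul
  intro x y
  rw [NNReal.coe_one, one_mul, Real.dist_eq, dist_eq_norm, abs_le]
  have h1 := opNorm_add_le (vecToMatrix (x - y)) (vecToMatrix y)
  have h2 := opNorm_add_le (vecToMatrix (y - x)) (vecToMatrix x)
  have h3 := opNorm_vecToMatrix_le (x - y)
  have h4 := opNorm_vecToMatrix_le (y - x)
  rw [norm_sub_rev] at h4
  simp only [vecToMatrix_sub, sub_add_cancel] at h1 h2 h3 h4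
  constructor <;> linarith

/-- A finite set of vectors of norm `2`, of cardinality at most `5 ^ d`, which almost norms. -/
lemma exists_norming_finset (G : Type*) [NormedAddCommGroup G] [InnerProductSpace ℝ G]
    [FiniteDimensional ℝ G] :
    ∃ s : Finset G, s.card ≤ 5 ^ Module.finrank ℝ G ∧ (∀ c ∈ s, ‖c‖ = 2) ∧
      ∀ w : G, w ≠ 0 → ∃ c ∈ s, ‖w‖ ≤ inner ℝ c w := by
  classical
  let P : Finset G → Prop := fun s => (∀ c ∈ s, ‖c‖ = 2) ∧ ∀ c ∈ s, ∀ d ∈ s, c ≠ d → 1 ≤ ‖c - d‖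
  have hbd : ∀ s, P s → s.card ≤ 5 ^ Module.finrank ℝ G := fun s hs =>
    Besicovitch.card_le_of_separated s (fun c hc => (hs.1 c hc).le) hs.2
  let Q : ℕ → Prop := fun k => ∃ s, P s ∧ s.card = k
  have hQ0 : Q 0 := ⟨∅, ⟨by simp, by simp⟩, rfl⟩
  -- A `1`-separated subset of the sphere of radius `2` has at most `5 ^ d` points, so one of
  -- maximal cardinality exists.
  obtain ⟨s, hs, hcard⟩ := Nat.findGreatest_spec (P := Q) (Nat.zero_le (5 ^ Module.finrank ℝ G)) hQ0
  refine ⟨s, hbd s hs, hs.1, fun w hw => ?_⟩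
  have hw' : 0 < ‖w‖ := norm_pos_iff.2 hw
  set w' : G := (2 / ‖w‖) • w with hw'def
  have hnw' : ‖w'‖ = 2 := by
    rw [hw'def, norm_smul, Real.norm_of_nonneg (by positivity)]
    field_simp
  have hinner : inner ℝ w' w = 2 * ‖w‖ := by
    rw [hw'def, real_inner_smul_left, real_inner_self_eq_norm_sq]
    field_simp
  -- By maximality every point of the sphere is at distance less than `1` from the set. Then `⟨c, w⟩
  -- ≥ ⟨w', w⟩ - ‖w‖ = ‖w‖`, which is why the radius is `2`.
  have hex : ∃ c ∈ s, ‖c - w'‖ < 1 := by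
    by_contra! hcon
    have hnot : w' ∉ s := fun h => by
      have := hcon w' h
      simp at this
      linarith
    have hP : P (insert w' s) := by
      refine ⟨?_, ?_⟩
      · intro c hc
        rcases Finset.mem_insert.1 hc with rfl | hc
        · exact hnw'
        · exact hs.1 c hc
      · intro c hc d hd hcd
        rcases Finset.mem_insert.1 hc with rfl | hc <;> rcases Finset.mem_insert.1 hd with rfl | hd
        · exact absurd rfl hcd
        · rw [norm_sub_rev]; exact hcon d hd
        · exact hcon c hc
        · exact hs.2 c hc d hd hcd
    have h1 := Nat.le_findGreatest (P := Q) (hbd _ hP) ⟨_, hP, rfl⟩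
    rw [Finset.card_insert_of_notMem hnot] at h1
    omega
  obtain ⟨c, hc, hcw⟩ := hex
  refine ⟨c, hc, ?_⟩
  have h1 : inner ℝ c w = inner ℝ w' w + inner ℝ (c - w') w := by
    rw [← inner_add_left]; congr 1; abel
  have h2 := neg_le_of_abs_le (abs_real_inner_le_norm (c - w') w)
  nlinarith

/-- The left net bounds `A d` for each `d` of the right net; the right net then bounds the adjoint
on all vectors. Since the nets dominate the full norm, no constant is lost. -/
lemma opNorm_le_of_norming {A : Matrix m n ℝ} [DecidableEq m] {T : ℝ} (hT : 0 ≤ T)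
    {s : Finset (EuclideanSpace ℝ m)}
    {t : Finset (EuclideanSpace ℝ n)} (hs : ∀ w, w ≠ 0 → ∃ c ∈ s, ‖w‖ ≤ inner ℝ c w)
    (ht : ∀ w, w ≠ 0 → ∃ d ∈ t, ‖w‖ ≤ inner ℝ d w)
    (h : ∀ c ∈ s, ∀ d ∈ t, inner ℝ c (Matrix.toEuclideanLin A d) ≤ T) : opNorm A ≤ T := by
  have h1 : ∀ d ∈ t, ‖Matrix.toEuclideanLin A d‖ ≤ T := by
    intro d hd
    by_cases h0 : Matrix.toEuclideanLin A d = 0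
    · rw [h0, norm_zero]; exact hT
    · obtain ⟨c, hc, hcd⟩ := hs _ h0
      exact hcd.trans (h c hc d hd)
  have h2 : ∀ x, ‖LinearMap.adjoint (Matrix.toEuclideanLin A) x‖ ≤ T * ‖x‖ := by
    intro x
    by_cases h0 : LinearMap.adjoint (Matrix.toEuclideanLin A) x = 0
    · rw [h0, norm_zero]; positivity
    · obtain ⟨d, hd, hdx⟩ := ht _ h0
      rw [LinearMap.adjoint_inner_right] at hdx
      calc _ ≤ _ := hdx
        _ ≤ ‖Matrix.toEuclideanLin A d‖ * ‖x‖ := real_inner_le_norm _ _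
        _ ≤ _ := by gcongr; exact h1 d hd
  refine opNorm_le_of_inner_le hT fun x y => ?_
  rw [← LinearMap.adjoint_inner_left]
  calc _ ≤ ‖LinearMap.adjoint (Matrix.toEuclideanLin A) x‖ * ‖y‖ := real_inner_le_norm _ _
    _ ≤ _ := by gcongr; exact h2 x

/-- The expected operator norm of a standard Gaussian matrix. -/
lemma integral_opNorm_stdGaussian_le [DecidableEq m] [Nonempty n] :
    ∫ x, opNorm (vecToMatrix x) ∂(stdGaussian (EuclideanSpace ℝ (m × n)))
      ≤ 12 * Real.sqrt (Fintype.card n + Fintype.card m) := by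
  obtain ⟨s, hs1, hs2, hs3⟩ := exists_norming_finset (EuclideanSpace ℝ m)
  obtain ⟨t, ht1, ht2, ht3⟩ := exists_norming_finset (EuclideanSpace ℝ n)
  rw [finrank_euclideanSpace] at hs1 ht1
  set N : ℝ := (Fintype.card n : ℝ) + Fintype.card m with hN
  have hN1 : 1 ≤ N := by
    have : 1 ≤ Fintype.card n := Fintype.card_pos
    have : (1 : ℝ) ≤ Fintype.card n := by exact_mod_cast this
    have : (0 : ℝ) ≤ Fintype.card m := by positivity
    linarith
  set l := Real.sqrt N with hl
  have hl2 : l ^ 2 = N := Real.sq_sqrt (by linarith)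
  have hl0 : 0 < l := Real.sqrt_pos.2 (by linarith)
  set γ := stdGaussian (EuclideanSpace ℝ (m × n))
  -- `H` dominates `exp (l * opNorm)`. Each tensor of net points has norm `4`, so each exponential
  -- has mean `exp (16 * l ^ 2 / 2) = exp (8 N)`, and there are at most `5 ^ (card m + card n) ≤ exp
  -- (2 N)` of them. The summand `1` makes `log H` nonnegative.
  set H : EuclideanSpace ℝ (m × n) → ℝ := fun x =>
    1 + ∑ c ∈ s, ∑ d ∈ t, Real.exp (l * inner ℝ (tensorVec c d) x) with hH
  have hterm : ∀ c ∈ s, ∀ d ∈ t,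
      Integrable (fun x => Real.exp (l * inner ℝ (tensorVec c d) x)) γ ∧
      ∫ x, Real.exp (l * inner ℝ (tensorVec c d) x) ∂γ ≤ Real.exp (8 * N) := by
    intro c hc d hd
    have h1 := lintegral_exp_dual_stdGaussian (l • innerSL ℝ (tensorVec c d))
    simp only [smul_apply, innerSL_apply_apply, smul_eq_mul] at h1
    have hint : Integrable (fun x => Real.exp (l * inner ℝ (tensorVec c d) x)) γ := by
      refine ⟨by apply Continuous.aestronglyMeasurable; fun_prop, ?_⟩
      rw [hasFiniteIntegral_iff_ofReal (Filter.Eventually.of_forall fun _ => by positivity), h1]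
      exact ENNReal.ofReal_lt_top
    refine ⟨hint, ?_⟩
    rw [integral_eq_lintegral_of_nonneg_ae (Filter.Eventually.of_forall fun _ => by positivity)
      hint.1, h1, ENNReal.toReal_ofReal (by positivity)]
    apply Real.exp_le_exp.2
    rw [norm_smul, innerSL_apply_norm, norm_tensorVec, hs2 c hc, ht2 d hd,
      Real.norm_of_nonneg hl0.le]
    nlinarith
  have hHint : Integrable H γ :=
    (integrable_const _).add (integrable_finsetSum _ fun c hc =>
      integrable_finsetSum _ fun d hd => (hterm c hc d hd).1)
  have hHle : ∫ x, H x ∂γ ≤ 1 + Real.exp (10 * N) := by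
    simp only [hH]
    rw [integral_add (integrable_const _) (integrable_finsetSum _ fun c hc =>
      integrable_finsetSum _ fun d hd => (hterm c hc d hd).1), integral_const, probReal_univ,
      one_smul, integral_finsetSum _ fun c hc =>
      integrable_finsetSum _ fun d hd => (hterm c hc d hd).1]
    have : ∑ c ∈ s, ∫ x, ∑ d ∈ t, Real.exp (l * inner ℝ (tensorVec c d) x) ∂γ
        ≤ ∑ c ∈ s, ∑ d ∈ t, Real.exp (8 * N) := by
      apply Finset.sum_le_sum
      intro c hc
      rw [integral_finsetSum _ fun d hd => (hterm c hc d hd).1]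
      exact Finset.sum_le_sum fun d hd => (hterm c hc d hd).2
    rw [Finset.sum_const, Finset.sum_const, nsmul_eq_mul, nsmul_eq_mul] at this
    have h5 : (5 : ℝ) ≤ Real.exp 2 := by
      have : Real.exp 2 = Real.exp 1 * Real.exp 1 := by rw [← Real.exp_add]; norm_num
      rw [this]
      nlinarith [Real.exp_one_gt_d9]
    have hcard : (s.card : ℝ) * t.card ≤ Real.exp (2 * N) := by
      calc (s.card : ℝ) * t.card ≤ (5 : ℝ) ^ Fintype.card m * (5 : ℝ) ^ Fintype.card n := by
            gcongr
            · exact_mod_cast hs1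
            · exact_mod_cast ht1
        _ ≤ (Real.exp 2) ^ Fintype.card m * (Real.exp 2) ^ Fintype.card n := by gcongr
        _ = _ := by
          rw [← Real.exp_nat_mul, ← Real.exp_nat_mul, ← Real.exp_add, hN]
          congr 1
          ring
    have : (s.card : ℝ) * (t.card * Real.exp (8 * N)) ≤ Real.exp (10 * N) := by
      calc _ = ((s.card : ℝ) * t.card) * Real.exp (8 * N) := by ring
        _ ≤ Real.exp (2 * N) * Real.exp (8 * N) := by gcongr
        _ = _ := by rw [← Real.exp_add]; congr 1; ring
    linarith
  -- Tangent line of `log` at `exp (10 N)`, in place of Jensen's inequality. Its expectation is at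
  -- most `10 N + 2 ≤ 12 N = 12 * l ^ 2`.
  have hpt : ∀ x, l * opNorm (vecToMatrix x) ≤ 10 * N + Real.exp (-(10 * N)) * H x := by
    intro x
    have hH1 : 1 ≤ H x := by
      simp only [hH]
      have : 0 ≤ ∑ c ∈ s, ∑ d ∈ t, Real.exp (l * inner ℝ (tensorVec c d) x) := by positivity
      linarith
    have hop : opNorm (vecToMatrix x) ≤ Real.log (H x) / l := by
      refine opNorm_le_of_norming (div_nonneg (Real.log_nonneg hH1) hl0.le) hs3 ht3 ?_
      intro c hc d hd
      rw [← inner_tensorVec, le_div_iff₀' hl0, Real.le_log_iff_exp_le (by linarith)]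
      have h1 : Real.exp (l * inner ℝ (tensorVec c d) x)
          ≤ ∑ d ∈ t, Real.exp (l * inner ℝ (tensorVec c d) x) :=
        Finset.single_le_sum (f := fun d => Real.exp (l * inner ℝ (tensorVec c d) x))
          (fun _ _ => by positivity) hd
      have h2 := Finset.single_le_sum
        (f := fun c => ∑ d ∈ t, Real.exp (l * inner ℝ (tensorVec c d) x))
        (fun _ _ => by positivity) hc
      simp only [hH] at *
      linarith
    rw [le_div_iff₀' hl0] at hop
    have h3 := Real.add_one_le_exp (Real.log (H x) - 10 * N)
    rw [Real.exp_sub, Real.exp_log (by linarith)] at h3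
    rw [Real.exp_neg, inv_mul_eq_div]
    linarith
  have hfi := integrable_of_lipschitz_stdGaussian (lipschitzWith_opNorm_vecToMatrix (m := m) (n := n))
  have hmain := integral_mono (hfi.const_mul l) ((integrable_const (10 * N)).add
    (hHint.const_mul (Real.exp (-(10 * N))))) hpt
  simp only [Pi.add_apply] at hmain
  rw [integral_const_mul, integral_add (integrable_const _) (hHint.const_mul _), integral_const,
    probReal_univ, one_smul, integral_const_mul] at hmain
  have h4 : Real.exp (-(10 * N)) * ∫ x, H x ∂γ ≤ 2 := by
    calc _ ≤ Real.exp (-(10 * N)) * (1 + Real.exp (10 * N)) := by gcongr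
      _ = Real.exp (-(10 * N)) + 1 := by
        rw [mul_add, ← Real.exp_add, neg_add_cancel, Real.exp_zero, mul_one]
      _ ≤ 2 := by
        have := Real.exp_le_one_iff.2 (by linarith : -(10 * N) ≤ 0)
        linarith
  have h5 : l * ∫ x, opNorm (vecToMatrix x) ∂γ ≤ l * (12 * l) := by nlinarith
  exact le_of_mul_le_mul_left h5 hl0

end OperatorNorm

/-! ### Nuclear norm and trace duality -/

section NuclearNorm

variable {m n : Type*} [Fintype m] [Fintype n] [DecidableEq n]

lemma nuclearNorm_nonneg (A : Matrix m n ℝ) : 0 ≤ nuclearNorm A :=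
  Finset.sum_nonneg fun _ _ => LinearMap.singularValues_nonneg _ _

lemma matInner_eq_trace [DecidableEq m] (A W : Matrix m n ℝ) :
    matInner A W = LinearMap.trace ℝ _
      (LinearMap.adjoint (Matrix.toEuclideanLin A) ∘ₗ Matrix.toEuclideanLin W) := by
  rw [LinearMap.trace_eq_sum_inner _ (EuclideanSpace.basisFun n ℝ)]
  simp only [LinearMap.comp_apply, LinearMap.adjoint_inner_right, matInner]
  rw [Finset.sum_comm]
  refine Finset.sum_congr rfl fun j _ => ?_
  simp [PiLp.inner_apply, Matrix.toLpLin_apply, mul_comm]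

/-- Duality between the operator norm and the nuclear norm. -/
lemma abs_matInner_le [DecidableEq m] (A W : Matrix m n ℝ) :
    |matInner A W| ≤ opNorm A * nuclearNorm W := by
  set T := Matrix.toEuclideanLin W with hT
  have hn : Module.finrank ℝ (EuclideanSpace ℝ n) = Fintype.card n := finrank_euclideanSpace
  -- The trace is evaluated in a basis of right singular vectors of `W`, whose images under `W` have
  -- the singular values as norms; Cauchy–Schwarz then works term by term.
  set b := T.isSymmetric_adjoint_comp_self.eigenvectorBasis hn with hb
  have hTb : ∀ i, ‖T (b i)‖ = T.singularValues i := by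
    intro i
    rw [LinearMap.singularValues_fin T hn i]
    have h1 := T.isSymmetric_adjoint_comp_self.apply_eigenvectorBasis hn i
    have h2 : ‖T (b i)‖ ^ 2 = T.isSymmetric_adjoint_comp_self.eigenvalues hn i := by
      rw [← real_inner_self_eq_norm_sq, ← LinearMap.adjoint_inner_right]
      rw [LinearMap.comp_apply] at h1
      rw [hb, h1, inner_smul_right, real_inner_self_eq_norm_sq, OrthonormalBasis.norm_eq_one]
      simp
    rw [← h2, Real.sqrt_sq (norm_nonneg _)]
  rw [matInner_eq_trace, LinearMap.trace_eq_sum_inner _ b, nuclearNorm, Finset.sum_range,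
    Finset.mul_sum]
  refine (Finset.abs_sum_le_sum_abs _ _).trans (Finset.sum_le_sum fun i _ => ?_)
  rw [LinearMap.comp_apply, LinearMap.adjoint_inner_right, ← hT]
  calc _ ≤ ‖Matrix.toEuclideanLin A (b i)‖ * ‖T (b i)‖ := abs_real_inner_le_norm _ _
    _ ≤ (opNorm A * ‖b i‖) * ‖T (b i)‖ := by gcongr; exact norm_toEuclideanLin_le A _
    _ = _ := by rw [OrthonormalBasis.norm_eq_one, mul_one, hTb]

end NuclearNorm

/-! ### Singular value decompositions and Weyl's inequality -/

section SVD

variable {p n r : ℕ} {A : Matrix (Fin p) (Fin n) ℝ} {σ : Fin r → ℝ}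
  {u : Fin r → EuclideanSpace ℝ (Fin p)} {v : Fin r → EuclideanSpace ℝ (Fin n)}

lemma toEuclideanLin_sum_smul_vecMulVec {m n ι : Type*} [Fintype m] [Fintype n] [DecidableEq n]
    [Fintype ι] (σ : ι → ℝ) (u : ι → EuclideanSpace ℝ m) (v : ι → EuclideanSpace ℝ n)
    (y : EuclideanSpace ℝ n) :
    Matrix.toEuclideanLin (∑ j, σ j • Matrix.vecMulVec (u j) (v j)) y
      = ∑ j, (σ j * inner ℝ (v j) y) • u j := by
  rw [map_sum, LinearMap.sum_apply]
  refine Finset.sum_congr rfl fun j _ => ?_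
  ext i
  simp [Matrix.toLpLin_apply, Matrix.vecMulVec_mulVec, PiLp.inner_apply, dotProduct, mul_comm,
    mul_left_comm]

namespace IsSVD

lemma apply (h : IsSVD A σ u v) (y : EuclideanSpace ℝ (Fin n)) :
    Matrix.toEuclideanLin A y = ∑ j, (σ j * inner ℝ (v j) y) • u j := by
  rw [h.eq_sum, toEuclideanLin_sum_smul_vecMulVec]

lemma transpose (h : IsSVD A σ u v) : IsSVD A.transpose σ v u where
  orthonormal_left := h.orthonormal_right
  orthonormal_right := h.orthonormal_left
  nonneg := h.nonneg
  antitone := h.antitone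
  eq_sum := by
    rw [h.eq_sum, Matrix.transpose_sum]
    simp [Matrix.transpose_vecMulVec]

lemma norm_apply_sq (h : IsSVD A σ u v) (y : EuclideanSpace ℝ (Fin n)) :
    ‖Matrix.toEuclideanLin A y‖ ^ 2 = ∑ j, (σ j * inner ℝ (v j) y) ^ 2 := by
  rw [h.apply, ← real_inner_self_eq_norm_sq, h.orthonormal_left.inner_sum]
  simp [sq]

lemma card_le (h : IsSVD A σ u v) : r ≤ min p n := by
  have h1 := h.orthonormal_left.linearIndependent.fintype_card_le_finrank
  have h2 := h.orthonormal_right.linearIndependent.fintype_card_le_finrank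
  simp only [Fintype.card_fin, finrank_euclideanSpace] at h1 h2
  omega

/-- Weyl's inequality for singular values. -/
lemma weyl (hA : IsSVD A σ u v) {s : ℕ} {B : Matrix (Fin p) (Fin n) ℝ} {τ : Fin s → ℝ}
    {u' : Fin s → EuclideanSpace ℝ (Fin p)} {v' : Fin s → EuclideanSpace ℝ (Fin n)}
    (hB : IsSVD B τ u' v') (i : Fin r) :
    σ i ≤ (if h : (i : ℕ) < s then τ ⟨i, h⟩ else 0) + opNorm (A - B) := by
  set t : ℝ := if h : (i : ℕ) < s then τ ⟨i, h⟩ else 0 with ht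
  have ht0 : 0 ≤ t := by
    rw [ht]; split_ifs
    · exact hB.nonneg _
    · exact le_rfl
  have hir : (i : ℕ) + 1 ≤ r := i.isLt
  let w : Fin ((i : ℕ) + 1) → EuclideanSpace ℝ (Fin n) := fun j => v (Fin.castLE hir j)
  have hw : Orthonormal ℝ w := hA.orthonormal_right.comp _ (Fin.castLE_injective hir)
  let φ : (Fin ((i : ℕ) + 1) → ℝ) →ₗ[ℝ] EuclideanSpace ℝ (Fin n) := Fintype.linearCombination ℝ w
  -- Indices `j ≥ s` get the zero functional: `B` has no such term, so they impose no condition.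
  let ψ : EuclideanSpace ℝ (Fin n) →ₗ[ℝ] (Fin (i : ℕ) → ℝ) := LinearMap.pi fun j =>
    if h : (j : ℕ) < s then (innerSL ℝ (v' ⟨j, h⟩)).toLinearMap else 0
  -- Dimension count: the span of the first `i + 1` right singular vectors of `A` contains a nonzero
  -- `y` killed by `i` functionals. There `A` stretches by at least `σ i` and `B` by at most `t`.
  obtain ⟨c, hc, hc0⟩ := (Submodule.ne_bot_iff _).1
    (LinearMap.ker_ne_bot_of_finrank_lt (f := ψ ∘ₗ φ) (by simp))
  set y := φ c with hy
  have hyw : y = ∑ j, c j • w j := by rw [hy]; simp [φ, Fintype.linearCombination_apply]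
  have hy0 : 0 < ‖y‖ := by
    refine norm_pos_iff.2 fun h0 => hc0 ?_
    rw [hyw] at h0
    exact funext (Fintype.linearIndependent_iff.1 hw.linearIndependent c h0)
  have horth : ∀ j : Fin s, (j : ℕ) < i → inner ℝ (v' j) y = 0 := by
    intro j hj
    have h1 : ψ y = 0 := hc
    have h2 := congrFun h1 ⟨j, hj⟩
    simpa [ψ] using h2
  have hB2 : ‖Matrix.toEuclideanLin B y‖ ≤ t * ‖y‖ := by
    apply le_of_sq_le_sq _ (by positivity)
    rw [hB.norm_apply_sq, mul_pow]
    calc _ ≤ ∑ j, t ^ 2 * (inner ℝ (v' j) y) ^ 2 := by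
          refine Finset.sum_le_sum fun j _ => ?_
          rw [mul_pow]
          by_cases hj : (j : ℕ) < i
          · rw [horth j hj]; simp
          · have his : (i : ℕ) < s := by omega
            have : τ j ≤ t := by
              rw [ht, dif_pos his]
              exact hB.antitone (by rw [Fin.le_def]; simp; omega)
            have := hB.nonneg j
            gcongr
      _ ≤ _ := by
          rw [← Finset.mul_sum]
          gcongr
          have := hB.orthonormal_right.sum_inner_products_le (s := Finset.univ) y
          simpa using this
  have hA2 : σ i * ‖y‖ ≤ ‖Matrix.toEuclideanLin A y‖ := by
    apply le_of_sq_le_sq _ (norm_nonneg _)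
    rw [hA.norm_apply_sq, mul_pow]
    have hny : ‖y‖ ^ 2 = ∑ j, c j ^ 2 := by
      rw [hyw, ← real_inner_self_eq_norm_sq, hw.inner_sum]
      simp [sq]
    have hwy : ∀ j, inner ℝ (w j) y = c j := by
      intro j
      rw [hyw, hw.inner_right_fintype]
    calc _ = ∑ j, σ i ^ 2 * c j ^ 2 := by rw [hny, Finset.mul_sum]
      _ ≤ ∑ j : Fin ((i : ℕ) + 1),
          (σ (Fin.castLE hir j) * inner ℝ (v (Fin.castLE hir j)) y) ^ 2 := by
          refine Finset.sum_le_sum fun j _ => ?_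
          rw [mul_pow]
          have h1 : inner ℝ (v (Fin.castLE hir j)) y = c j := hwy j
          rw [h1]
          have h2 : σ i ≤ σ (Fin.castLE hir j) := hA.antitone (by
            rw [Fin.le_def]; simp; omega)
          have := hA.nonneg i
          gcongr
      _ ≤ _ := by
          rw [← Finset.sum_image (s := Finset.univ) (g := Fin.castLE hir)
            (f := fun j => (σ j * inner ℝ (v j) y) ^ 2)
            (fun a _ b _ hab => Fin.castLE_injective hir hab)]
          exact Finset.sum_le_sum_of_subset_of_nonneg (Finset.subset_univ _)
            (fun _ _ _ => sq_nonneg _)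
  have h3 : Matrix.toEuclideanLin A y
      = Matrix.toEuclideanLin (A - B) y + Matrix.toEuclideanLin B y := by
    rw [map_sub, LinearMap.sub_apply]; abel
  have h4 := norm_toEuclideanLin_le (A - B) y
  have h5 : σ i * ‖y‖ ≤ (t + opNorm (A - B)) * ‖y‖ := by
    calc _ ≤ _ := hA2
      _ ≤ ‖Matrix.toEuclideanLin (A - B) y‖ + ‖Matrix.toEuclideanLin B y‖ :=
          h3 ▸ norm_add_le _ _
      _ ≤ _ := by linarith
  exact le_of_mul_le_mul_right h5 hy0

end IsSVD

end SVD

/-! ### The Hermitian dilation -/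

section Dilation

open scoped Matrix.Norms.L2Operator Matrix

variable {m n : Type*} [Fintype m] [Fintype n] [DecidableEq m] [DecidableEq n]

/-- The Hermitian dilation of a real matrix, as a complex matrix. -/
noncomputable def dilation {m n : Type*} (A : Matrix m n ℝ) : Matrix (m ⊕ n) (m ⊕ n) ℂ :=
  Matrix.fromBlocks 0 (A.map (algebraMap ℝ ℂ)) (A.transpose.map (algebraMap ℝ ℂ)) 0

lemma dilation_sub {m n : Type*} (A B : Matrix m n ℝ) :
    dilation (A - B) = dilation A - dilation B := by
  ext (i | i) (j | j) <;> simp [dilation]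

lemma dilation_add {m n : Type*} (A B : Matrix m n ℝ) :
    dilation (A + B) = dilation A + dilation B := by
  ext (i | i) (j | j) <;> simp [dilation]

lemma dilation_transpose {m n : Type*} (A : Matrix m n ℝ) : (dilation A).transpose = dilation A := by
  ext (i | i) (j | j) <;> simp [dilation]

lemma dilation_isHermitian {m n : Type*} (A : Matrix m n ℝ) : (dilation A).IsHermitian := by
  ext (i | i) (j | j) <;> simp [dilation]

omit [DecidableEq m] in
lemma sum_sq_mulVec_le (A : Matrix m n ℝ) (y : n → ℝ) :
    ∑ i, (∑ j, A i j * y j) ^ 2 ≤ opNorm A ^ 2 * ∑ j, y j ^ 2 := by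
  have h := norm_toEuclideanLin_le A (WithLp.toLp 2 y)
  have h2 := pow_le_pow_left₀ (norm_nonneg _) h 2
  rw [mul_pow, EuclideanSpace.norm_sq_eq, EuclideanSpace.norm_sq_eq] at h2
  simpa [Matrix.toLpLin_apply, Matrix.mulVec, dotProduct] using h2

lemma opNorm_transpose_le (A : Matrix m n ℝ) : opNorm A.transpose ≤ opNorm A := by
  refine opNorm_le_of_inner_le (opNorm_nonneg A) fun x y => ?_
  have h := abs_inner_toEuclideanLin_le A y x
  rw [inner_toEuclideanLin_eq_sum] at *
  rw [Finset.sum_comm] at h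
  calc _ ≤ _ := le_abs_self _
    _ = |∑ j, ∑ i, y i * A i j * x j| := by
      congr 1
      exact Finset.sum_congr rfl fun i _ => Finset.sum_congr rfl fun j _ => by
        simp only [Matrix.transpose_apply]; ring
    _ ≤ _ := by linarith

omit [DecidableEq m] in
lemma sum_normSq_mulVec_le (A : Matrix m n ℝ) (y : n → ℂ) :
    ∑ i, ‖∑ j, (A i j : ℂ) * y j‖ ^ 2 ≤ opNorm A ^ 2 * ∑ j, ‖y j‖ ^ 2 := by
  have h1 := sum_sq_mulVec_le A fun j => (y j).re
  have h2 := sum_sq_mulVec_le A fun j => (y j).im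
  have hn : ∀ w : ℂ, ‖w‖ ^ 2 = w.re ^ 2 + w.im ^ 2 := fun w => by
    rw [Complex.sq_norm, Complex.normSq_apply]; ring
  simp only [hn, Finset.sum_add_distrib, mul_add]
  simpa [Complex.re_sum, Complex.im_sum] using add_le_add h1 h2

/-- The two off-diagonal blocks act on separate halves of the vector, and a real matrix acts on real
and imaginary parts separately, so the real operator norm controls the complex one. -/
lemma norm_dilation_le (A : Matrix m n ℝ) : ‖dilation A‖ ≤ opNorm A := by
  rw [Matrix.cstar_norm_def]
  refine ContinuousLinearMap.opNorm_le_bound _ (opNorm_nonneg A) fun ξ => ?_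
  apply le_of_sq_le_sq _ (mul_nonneg (opNorm_nonneg A) (norm_nonneg _))
  rw [mul_pow, EuclideanSpace.norm_sq_eq, EuclideanSpace.norm_sq_eq]
  have h1 := sum_normSq_mulVec_le A fun j => ξ (Sum.inr j)
  have h2 := sum_normSq_mulVec_le A.transpose fun i => ξ (Sum.inl i)
  have h3 : opNorm A.transpose ^ 2 ≤ opNorm A ^ 2 :=
    pow_le_pow_left₀ (opNorm_nonneg _) (opNorm_transpose_le A) 2
  have h4 : 0 ≤ ∑ i, ‖ξ (Sum.inl i)‖ ^ 2 := by positivity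
  have h5 := mul_le_mul_of_nonneg_right h3 h4
  simp only [Fintype.sum_sum_type, Matrix.ofLp_toEuclideanCLM, Matrix.mulVec, dotProduct, dilation,
    Matrix.fromBlocks_apply₁₁, Matrix.fromBlocks_apply₁₂, Matrix.fromBlocks_apply₂₁,
    Matrix.fromBlocks_apply₂₂, Matrix.zero_apply, zero_mul, Finset.sum_const_zero, zero_add,
    add_zero, Matrix.map_apply, Complex.coe_algebraMap]
  linarith

end Dilation

/-! ### Inverses from lower bounds, and distance to the spectrum -/

section BoundedBelow

open scoped Matrix.Norms.L2Operator Matrix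

variable {ι : Type*} [Fintype ι] [DecidableEq ι]

lemma isUnit_and_norm_inv_le {B : Matrix ι ι ℂ} {d : ℝ} (hd : 0 < d)
    (h : ∀ ξ : EuclideanSpace ℂ ι, d * ‖ξ‖ ≤ ‖Matrix.toEuclideanCLM (𝕜 := ℂ) B ξ‖) :
    IsUnit B ∧ ‖B⁻¹‖ ≤ d⁻¹ := by
  have hu : IsUnit B := by
    rw [← Matrix.mulVec_injective_iff_isUnit]
    intro x y hxy
    have h1 := h (WithLp.toLp 2 (x - y))
    rw [Matrix.toEuclideanCLM_toLp, Matrix.mulVec_sub, hxy, sub_self] at h1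
    have h2 : ‖WithLp.toLp 2 (x - y)‖ = 0 := by
      rw [WithLp.toLp_zero, norm_zero] at h1
      nlinarith [norm_nonneg (WithLp.toLp 2 (x - y))]
    rw [norm_eq_zero, WithLp.toLp_eq_zero] at h2
    exact sub_eq_zero.1 h2
  refine ⟨hu, ?_⟩
  rw [Matrix.cstar_norm_def]
  refine ContinuousLinearMap.opNorm_le_bound _ (by positivity) fun ξ => ?_
  have h1 := h (Matrix.toEuclideanCLM (𝕜 := ℂ) B⁻¹ ξ)
  have h2 : Matrix.toEuclideanCLM (𝕜 := ℂ) B (Matrix.toEuclideanCLM (𝕜 := ℂ) B⁻¹ ξ) = ξ := by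
    apply WithLp.ofLp_injective
    rw [Matrix.ofLp_toEuclideanCLM, Matrix.ofLp_toEuclideanCLM, Matrix.mulVec_mulVec,
      Matrix.mul_nonsing_inv _ ((Matrix.isUnit_iff_isUnit_det _).1 hu), Matrix.one_mulVec]
  rw [h2] at h1
  rw [inv_mul_eq_div, le_div_iff₀' hd]
  exact h1

/-- In an orthonormal eigenbasis of `X` the coordinates of the image are those of `ξ` multiplied by
`z - l`. -/
lemma norm_sub_apply_ge {X : Matrix ι ι ℂ} (hX : X.IsHermitian) {z : ℂ} {d : ℝ} (hd : 0 ≤ d)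
    (h : ∀ (l : ℝ) (ξ : ι → ℂ), ξ ≠ 0 → X *ᵥ ξ = (l : ℂ) • ξ → d ≤ ‖z - l‖)
    (ξ : EuclideanSpace ℂ ι) :
    d * ‖ξ‖ ≤ ‖Matrix.toEuclideanCLM (𝕜 := ℂ) (z • (1 : Matrix ι ι ℂ) - X) ξ‖ := by
  set b := hX.eigenvectorBasis
  apply le_of_sq_le_sq _ (norm_nonneg _)
  rw [mul_pow, ← b.sum_sq_norm_inner_right ξ, ← b.sum_sq_norm_inner_right, Finset.mul_sum]
  refine Finset.sum_le_sum fun i _ => ?_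
  have hbi := hX.mulVec_eigenvectorBasis i
  have hX' : inner ℂ (b i) (Matrix.toEuclideanCLM (𝕜 := ℂ) X ξ)
      = (hX.eigenvalues i : ℂ) * inner ℂ (b i) ξ := by
    have hsymm := (Matrix.isSymmetric_toEuclideanLin_iff.2 hX) (b i) ξ
    have h1 : Matrix.toEuclideanLin X (b i) = (hX.eigenvalues i : ℂ) • b i := by
      ext j
      have := congrFun hbi j
      simpa [Matrix.toLpLin_apply] using this
    rw [h1, inner_smul_left, Complex.conj_ofReal] at hsymm
    rw [hsymm]
    rfl
  have h2 : inner ℂ (b i) (Matrix.toEuclideanCLM (𝕜 := ℂ) (z • (1 : Matrix ι ι ℂ) - X) ξ)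
      = (z - hX.eigenvalues i) * inner ℂ (b i) ξ := by
    rw [map_sub, map_smul, map_one, sub_apply, inner_sub_right, hX', smul_apply,
      one_apply_eq_self, inner_smul_right, sub_mul]
  rw [h2, norm_mul, mul_pow]
  gcongr
  refine h _ (b i).ofLp ?_ ?_
  · intro h0
    have := b.orthonormal.ne_zero i
    exact this ((WithLp.ofLp_eq_zero 2).1 h0)
  · simpa using hbi

end BoundedBelow

/-! ### Explicit resolvent of the dilation -/

section Resolvent

open scoped Matrix.Norms.L2Operator Matrix

/-- The vector `(0, y)` in the space on which the dilation acts. -/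
noncomputable def inrVec (m : Type*) {n : Type*} [Fintype n] (y : EuclideanSpace ℝ n) : m ⊕ n → ℂ :=
  Sum.elim 0 fun j => (y j : ℂ)

/-- The bilinear form `(0, x)ᵀ B (0, y)`. -/
noncomputable def lowerForm {m n : Type*} [Fintype m] [Fintype n] (B : Matrix (m ⊕ n) (m ⊕ n) ℂ)
    (x y : EuclideanSpace ℝ n) : ℂ :=
  inrVec m x ⬝ᵥ (B *ᵥ inrVec m y)

section

variable {m n : Type*} [Fintype m] [Fintype n]

lemma lowerForm_sub (B B' : Matrix (m ⊕ n) (m ⊕ n) ℂ) (x y : EuclideanSpace ℝ n) :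
    lowerForm (B - B') x y = lowerForm B x y - lowerForm B' x y := by
  rw [lowerForm, Matrix.sub_mulVec, dotProduct_sub]; rfl

lemma norm_lowerForm_le [DecidableEq m] [DecidableEq n] (B : Matrix (m ⊕ n) (m ⊕ n) ℂ)
    (x y : EuclideanSpace ℝ n) :
    ‖lowerForm B x y‖ ≤ ‖B‖ * ‖x‖ * ‖y‖ := by
  have hnorm : ∀ y : EuclideanSpace ℝ n, ‖WithLp.toLp 2 (inrVec m y)‖ = ‖y‖ := by
    intro y
    rw [EuclideanSpace.norm_eq, EuclideanSpace.norm_eq]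
    simp [inrVec]
  have h1 : lowerForm B x y = inner ℂ (WithLp.toLp 2 (inrVec m x))
      (Matrix.toEuclideanCLM (𝕜 := ℂ) B (WithLp.toLp 2 (inrVec m y))) := by
    rw [lowerForm, dotProduct_comm, EuclideanSpace.inner_eq_star_dotProduct,
      Matrix.ofLp_toEuclideanCLM]
    congr 1
    ext (i | i) <;> simp [inrVec]
  rw [h1]
  refine (norm_inner_le_norm _ _).trans ?_
  have h2 := (Matrix.toEuclideanCLM (𝕜 := ℂ) B).le_opNorm (WithLp.toLp 2 (inrVec m y))
  rw [← Matrix.cstar_norm_def, hnorm] at h2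
  rw [hnorm]
  calc _ ≤ ‖x‖ * (‖B‖ * ‖y‖) := by gcongr
    _ = _ := by ring

end

lemma Orthonormal.sum_ofReal_mul {m : Type*} [Fintype m] {r : ℕ} {u : Fin r → EuclideanSpace ℝ m}
    (hu : Orthonormal ℝ u) (c : Fin r → ℂ) (l : Fin r) :
    ∑ i, (u l i : ℂ) * ∑ l', c l' * (u l' i : ℂ) = c l := by
  have h : ∀ l', ∑ i, (u l i : ℂ) * (u l' i : ℂ) = if l = l' then 1 else 0 := by
    intro l'
    have := (orthonormal_iff_ite.1 hu) l l'
    rw [PiLp.inner_apply] at this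
    have h2 : ∑ i, u l i * u l' i = if l = l' then 1 else 0 := by
      rw [← this]
      exact Finset.sum_congr rfl fun i _ => by simp [mul_comm]
    have h3 := congrArg (fun x : ℝ => (x : ℂ)) h2
    simpa [apply_ite Complex.ofReal] using h3
  calc _ = ∑ l', c l' * ∑ i, (u l i : ℂ) * (u l' i : ℂ) := by
        simp only [Finset.mul_sum]
        rw [Finset.sum_comm]
        exact Finset.sum_congr rfl fun l' _ => Finset.sum_congr rfl fun i _ => by ring
    _ = _ := by simp [h]

lemma ofReal_inner_eq_sum {n : Type*} [Fintype n] (v y : EuclideanSpace ℝ n) :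
    ((inner ℝ v y : ℝ) : ℂ) = ∑ j, (v j : ℂ) * (y j : ℂ) := by
  rw [PiLp.inner_apply, Complex.ofReal_sum]
  exact Finset.sum_congr rfl fun i _ => by simp [mul_comm]

namespace IsSVD

variable {p n r : ℕ} {A : Matrix (Fin p) (Fin n) ℝ} {σ : Fin r → ℝ}
  {u : Fin r → EuclideanSpace ℝ (Fin p)} {v : Fin r → EuclideanSpace ℝ (Fin n)}

lemma dilation_mulVec_inl (h : IsSVD A σ u v) (ξ : Fin p ⊕ Fin n → ℂ) (i : Fin p) :
    (dilation A *ᵥ ξ) (Sum.inl i)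
      = ∑ l, (σ l * ∑ j, (v l j : ℂ) * ξ (Sum.inr j)) * (u l i : ℂ) := by
  have hA : ∀ i j, A i j = ∑ l, σ l * (u l i * v l j) := by
    intro i j
    rw [h.eq_sum, Matrix.sum_apply]
    simp [Matrix.vecMulVec_apply]
  simp only [Matrix.mulVec, dotProduct, Fintype.sum_sum_type, dilation, Matrix.fromBlocks_apply₁₁,
    Matrix.fromBlocks_apply₁₂, Matrix.zero_apply, zero_mul, Finset.sum_const_zero, zero_add,
    Matrix.map_apply, Complex.coe_algebraMap, hA, Complex.ofReal_sum, Finset.sum_mul,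
    Finset.mul_sum, Complex.ofReal_mul]
  rw [Finset.sum_comm]
  exact Finset.sum_congr rfl fun l _ => Finset.sum_congr rfl fun j _ => by ring

lemma dilation_mulVec_inr (h : IsSVD A σ u v) (ξ : Fin p ⊕ Fin n → ℂ) (j : Fin n) :
    (dilation A *ᵥ ξ) (Sum.inr j)
      = ∑ l, (σ l * ∑ i, (u l i : ℂ) * ξ (Sum.inl i)) * (v l j : ℂ) := by
  have := h.transpose.dilation_mulVec_inl (Sum.elim (ξ ∘ Sum.inr) (ξ ∘ Sum.inl)) j
  simp only [Sum.elim_inr, Function.comp_apply] at this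
  rw [← this]
  simp [Matrix.mulVec, dotProduct, dilation]

/-- The coordinates of an eigenvector along `u a` and `v a` satisfy `σ β = l α` and `σ α = l β`, so
`(l ^ 2 - σ ^ 2) α = 0`. If `l` is none of the listed values, all coordinates vanish, and since `l ≠
0` the eigenvector lies in their span. -/
lemma eigenvalue_dilation (h : IsSVD A σ u v) {l : ℝ} {ξ : Fin p ⊕ Fin n → ℂ} (hξ : ξ ≠ 0)
    (hl : dilation A *ᵥ ξ = (l : ℂ) • ξ) : l = 0 ∨ ∃ j, l = σ j ∨ l = -σ j := by
  by_contra! hcon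
  obtain ⟨hl0, hlj⟩ := hcon
  set α : Fin r → ℂ := fun a => ∑ i, (u a i : ℂ) * ξ (Sum.inl i) with hα
  set β : Fin r → ℂ := fun a => ∑ j, (v a j : ℂ) * ξ (Sum.inr j) with hβ
  have e1 : ∀ i, ∑ a, (σ a * β a) * (u a i : ℂ) = l * ξ (Sum.inl i) := fun i => by
    rw [← h.dilation_mulVec_inl ξ i, hl]; rfl
  have e2 : ∀ j, ∑ a, (σ a * α a) * (v a j : ℂ) = l * ξ (Sum.inr j) := fun j => by
    rw [← h.dilation_mulVec_inr ξ j, hl]; rfl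
  have f1 : ∀ a, σ a * β a = l * α a := by
    intro a
    rw [← Orthonormal.sum_ofReal_mul h.orthonormal_left (fun a => (σ a : ℂ) * β a) a]
    simp only [e1, hα, Finset.mul_sum]
    exact Finset.sum_congr rfl fun i _ => by ring
  have f2 : ∀ a, σ a * α a = l * β a := by
    intro a
    rw [← Orthonormal.sum_ofReal_mul h.orthonormal_right (fun a => (σ a : ℂ) * α a) a]
    simp only [e2, hβ, Finset.mul_sum]
    exact Finset.sum_congr rfl fun i _ => by ring
  have hl0' : (l : ℂ) ≠ 0 := by exact_mod_cast hl0
  have hα0 : ∀ a, α a = 0 := by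
    intro a
    have h1 : ((l - σ a : ℝ) : ℂ) * ((l + σ a : ℝ) : ℂ) * α a = 0 := by
      push_cast
      linear_combination (-(l : ℂ)) * f1 a - (σ a : ℂ) * f2 a
    have h2 : ((l - σ a : ℝ) : ℂ) ≠ 0 := by
      exact_mod_cast sub_ne_zero.2 (hlj a).1
    have h3 : ((l + σ a : ℝ) : ℂ) ≠ 0 := by
      have : l + σ a ≠ 0 := fun h => (hlj a).2 (by linarith)
      exact_mod_cast this
    exact (mul_eq_zero.1 h1).resolve_left (mul_ne_zero h2 h3)
  have hβ0 : ∀ a, β a = 0 := by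
    intro a
    have := f2 a
    rw [hα0, mul_zero] at this
    simpa [hl0'] using this.symm
  apply hξ
  ext (i | j)
  · have := e1 i
    simp only [hβ0, mul_zero, zero_mul, Finset.sum_const_zero] at this
    simpa [hl0'] using this.symm
  · have := e2 j
    simp only [hα0, mul_zero, zero_mul, Finset.sum_const_zero] at this
    simpa [hl0'] using this.symm

/-- The resolvent of the dilation applied to `(0, y)`. -/
lemma resolvent_mulVec (h : IsSVD A σ u v) {z : ℂ} (hz : z ≠ 0) (hzσ : ∀ j, z ^ 2 - σ j ^ 2 ≠ 0)
    (hu : IsUnit (z • (1 : Matrix (Fin p ⊕ Fin n) (Fin p ⊕ Fin n) ℂ) - dilation A))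
    (y : EuclideanSpace ℝ (Fin n)) :
    (z • (1 : Matrix (Fin p ⊕ Fin n) (Fin p ⊕ Fin n) ℂ) - dilation A)⁻¹ *ᵥ inrVec (Fin p) y
      = Sum.elim
        (fun i => ∑ l, ((inner ℝ (v l) y : ℝ) * (σ l / (z ^ 2 - σ l ^ 2))) * (u l i : ℂ))
        (fun j => ∑ l, ((inner ℝ (v l) y : ℝ) * (z / (z ^ 2 - σ l ^ 2) - z⁻¹)) * (v l j : ℂ)
          + z⁻¹ * (y j : ℂ)) := by
  -- The candidate solves a two by two system with determinant `z ^ 2 - σ l ^ 2` on each pair `u l`,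
  -- `v l`, and is `z⁻¹ y` off the span of the `v l`; the `- z⁻¹` corrects for using all of `y` in
  -- the last term.
  set w : Fin p ⊕ Fin n → ℂ := Sum.elim
        (fun i => ∑ l, ((inner ℝ (v l) y : ℝ) * (σ l / (z ^ 2 - σ l ^ 2))) * (u l i : ℂ))
        (fun j => ∑ l, ((inner ℝ (v l) y : ℝ) * (z / (z ^ 2 - σ l ^ 2) - z⁻¹)) * (v l j : ℂ)
          + z⁻¹ * (y j : ℂ)) with hw
  have hα : ∀ a, ∑ i, (u a i : ℂ) * w (Sum.inl i)
      = (inner ℝ (v a) y : ℝ) * (σ a / (z ^ 2 - σ a ^ 2)) := fun a => by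
    simp only [hw, Sum.elim_inl]
    exact Orthonormal.sum_ofReal_mul h.orthonormal_left _ a
  have hβ : ∀ a, ∑ j, (v a j : ℂ) * w (Sum.inr j)
      = (inner ℝ (v a) y : ℝ) * (z / (z ^ 2 - σ a ^ 2)) := fun a => by
    simp only [hw, Sum.elim_inr, mul_add, Finset.sum_add_distrib]
    rw [Orthonormal.sum_ofReal_mul h.orthonormal_right
      (fun l => (inner ℝ (v l) y : ℝ) * (z / (z ^ 2 - σ l ^ 2) - z⁻¹)) a]
    have : ∑ j, (v a j : ℂ) * (z⁻¹ * (y j : ℂ)) = z⁻¹ * (inner ℝ (v a) y : ℝ) := by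
      rw [ofReal_inner_eq_sum, Finset.mul_sum]
      exact Finset.sum_congr rfl fun j _ => by ring
    rw [this]
    ring
  have key : (z • (1 : Matrix (Fin p ⊕ Fin n) (Fin p ⊕ Fin n) ℂ) - dilation A) *ᵥ w
      = inrVec (Fin p) y := by
    rw [Matrix.sub_mulVec, Matrix.smul_mulVec, Matrix.one_mulVec]
    ext (i | j)
    · rw [Pi.sub_apply, Pi.smul_apply, h.dilation_mulVec_inl]
      simp only [hβ, inrVec, Sum.elim_inl, Pi.zero_apply]
      simp only [hw, Sum.elim_inl, smul_eq_mul, Finset.mul_sum]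
      rw [← Finset.sum_sub_distrib]
      exact Finset.sum_eq_zero fun l _ => by ring
    · rw [Pi.sub_apply, Pi.smul_apply, h.dilation_mulVec_inr]
      simp only [hα, inrVec, Sum.elim_inr]
      simp only [hw, Sum.elim_inr, smul_eq_mul, mul_add, Finset.mul_sum]
      rw [mul_inv_cancel_left₀ hz, add_sub_right_comm, ← Finset.sum_sub_distrib]
      rw [Finset.sum_eq_zero, zero_add]
      intro l _
      have := hzσ l
      field_simp
      ring
  rw [← key, Matrix.mulVec_mulVec,
    Matrix.nonsing_inv_mul _ ((Matrix.isUnit_iff_isUnit_det _).1 hu), Matrix.one_mulVec]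

lemma lowerForm_resolvent (h : IsSVD A σ u v) {z : ℂ} (hz : z ≠ 0)
    (hzσ : ∀ j, z ^ 2 - σ j ^ 2 ≠ 0)
    (hu : IsUnit (z • (1 : Matrix (Fin p ⊕ Fin n) (Fin p ⊕ Fin n) ℂ) - dilation A))
    (x y : EuclideanSpace ℝ (Fin n)) :
    lowerForm (z • (1 : Matrix (Fin p ⊕ Fin n) (Fin p ⊕ Fin n) ℂ) - dilation A)⁻¹ x y
      = ∑ l, ((inner ℝ (v l) x * inner ℝ (v l) y : ℝ) : ℂ) * (z / (z ^ 2 - σ l ^ 2) - z⁻¹)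
        + (inner ℝ x y : ℝ) * z⁻¹ := by
  rw [lowerForm, h.resolvent_mulVec hz hzσ hu]
  simp only [inrVec, dotProduct, Fintype.sum_sum_type, Sum.elim_inl, Sum.elim_inr, Pi.zero_apply,
    zero_mul, Finset.sum_const_zero, zero_add, mul_add, Finset.sum_add_distrib]
  congr 1
  · simp only [Finset.mul_sum]
    rw [Finset.sum_comm]
    refine Finset.sum_congr rfl fun l _ => ?_
    rw [Complex.ofReal_mul, ofReal_inner_eq_sum (v l) x, Finset.sum_mul, Finset.sum_mul]
    exact Finset.sum_congr rfl fun j _ => by ring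
  · rw [ofReal_inner_eq_sum, Finset.sum_mul]
    exact Finset.sum_congr rfl fun j _ => by ring

/-- The linear term of the resolvent expansion, tested against a vector in the kernel. -/
lemma lowerForm_resolvent_dilation_resolvent (h : IsSVD A σ u v) {z : ℂ} (hz : z ≠ 0)
    (hzσ : ∀ j, z ^ 2 - σ j ^ 2 ≠ 0)
    (hu : IsUnit (z • (1 : Matrix (Fin p ⊕ Fin n) (Fin p ⊕ Fin n) ℂ) - dilation A))
    (D : Matrix (Fin p) (Fin n) ℝ) (x y : EuclideanSpace ℝ (Fin n))
    (hx : ∀ j, inner ℝ (v j) x = 0) :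
    lowerForm ((z • (1 : Matrix (Fin p ⊕ Fin n) (Fin p ⊕ Fin n) ℂ) - dilation A)⁻¹ * dilation D *
        (z • (1 : Matrix (Fin p ⊕ Fin n) (Fin p ⊕ Fin n) ℂ) - dilation A)⁻¹) x y
      = ∑ l, ((inner ℝ (u l) (Matrix.toEuclideanLin D x) * inner ℝ (v l) y : ℝ) : ℂ) *
          (σ l / (z * (z ^ 2 - σ l ^ 2))) := by
  set B := z • (1 : Matrix (Fin p ⊕ Fin n) (Fin p ⊕ Fin n) ℂ) - dilation A with hB
  have hBt : B⁻¹.transpose = B⁻¹ := by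
    rw [Matrix.transpose_nonsing_inv, hB, Matrix.transpose_sub, dilation_transpose,
      Matrix.transpose_smul, Matrix.transpose_one]
  -- As `x` is orthogonal to every `v j`, the vector `(0, x)` is in the kernel of the dilation, and
  -- the symmetric resolvent acts on it as `z⁻¹`.
  have hleft : inrVec (Fin p) x ᵥ* B⁻¹ = z⁻¹ • inrVec (Fin p) x := by
    rw [← Matrix.mulVec_transpose, hBt, h.resolvent_mulVec hz hzσ hu]
    ext (i | j) <;> simp [hx, inrVec]
  rw [lowerForm, mul_assoc, ← Matrix.mulVec_mulVec, Matrix.dotProduct_mulVec, hleft,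
    smul_dotProduct, ← Matrix.mulVec_mulVec, h.resolvent_mulVec hz hzσ hu]
  have hD : ∀ l, ((inner ℝ (u l) (Matrix.toEuclideanLin D x) : ℝ) : ℂ)
      = ∑ j, ∑ i, (u l i : ℂ) * (D i j : ℂ) * (x j : ℂ) := by
    intro l
    rw [inner_toEuclideanLin_eq_sum, Finset.sum_comm]
    push_cast
    rfl
  simp only [inrVec, dotProduct, Fintype.sum_sum_type, Sum.elim_inl, Sum.elim_inr, Pi.zero_apply,
    zero_mul, Finset.sum_const_zero, zero_add, Matrix.mulVec, dilation, Matrix.fromBlocks_apply₂₁,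
    Matrix.fromBlocks_apply₂₂, Matrix.zero_apply, add_zero, Matrix.map_apply,
    Matrix.transpose_apply, Complex.coe_algebraMap, smul_eq_mul, Complex.ofReal_mul, hD,
    Finset.mul_sum, Finset.sum_mul]
  have hcomm : ∀ F : Fin n → Fin p → Fin r → ℂ,
      ∑ j, ∑ i, ∑ l, F j i l = ∑ l, ∑ j, ∑ i, F j i l := by
    intro F
    simp_rw [fun j => Finset.sum_comm (s := Finset.univ) (t := Finset.univ) (f := F j)]
    rw [Finset.sum_comm]
  rw [hcomm]
  refine Finset.sum_congr rfl fun l _ => Finset.sum_congr rfl fun j _ =>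
    Finset.sum_congr rfl fun i _ => ?_
  have := hzσ l
  field_simp

end IsSVD

end Resolvent

/-! ### Contour integrals of partial fractions -/

section CircleIntegrals

open scoped Real

/-- `f` is integrable on the circle and its integral there is `I`. -/
def HasCircleIntegral (f : ℂ → ℂ) (c : ℂ) (R : ℝ) (I : ℂ) : Prop :=
  CircleIntegrable f c R ∧ (∮ z in C(c, R), f z) = I

namespace HasCircleIntegral

variable {f g : ℂ → ℂ} {c : ℂ} {R : ℝ} {I J : ℂ}

lemma add (hf : HasCircleIntegral f c R I) (hg : HasCircleIntegral g c R J) :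
    HasCircleIntegral (fun z => f z + g z) c R (I + J) :=
  ⟨hf.1.add hg.1, by rw [circleIntegral.integral_add hf.1 hg.1, hf.2, hg.2]⟩

lemma sub (hf : HasCircleIntegral f c R I) (hg : HasCircleIntegral g c R J) :
    HasCircleIntegral (fun z => f z - g z) c R (I - J) :=
  ⟨hf.1.sub hg.1, by rw [circleIntegral.integral_sub hf.1 hg.1, hf.2, hg.2]⟩

lemma const_mul (a : ℂ) (hf : HasCircleIntegral f c R I) :
    HasCircleIntegral (fun z => a * f z) c R (a * I) :=
  ⟨hf.1.const_smul (a := a), by rw [circleIntegral.integral_const_mul, hf.2]⟩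

lemma sum {ι : Type*} (s : Finset ι) {F : ι → ℂ → ℂ} {I : ι → ℂ}
    (h : ∀ i ∈ s, HasCircleIntegral (F i) c R (I i)) :
    HasCircleIntegral (fun z => ∑ i ∈ s, F i z) c R (∑ i ∈ s, I i) := by
  classical
  induction s using Finset.induction_on with
  | empty => simpa using ⟨circleIntegrable_const (0 : ℂ) c R, by simp [circleIntegral]⟩
  | insert i s hi ih =>
    simp only [Finset.sum_insert hi]
    exact (h i (Finset.mem_insert_self i s)).add
      (ih fun j hj => h j (Finset.mem_insert_of_mem hj))

lemma congr (hR : 0 ≤ R) (hf : HasCircleIntegral f c R I)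
    (h : ∀ z ∈ Metric.sphere c R, f z = g z) : HasCircleIntegral g c R I := by
  refine ⟨(circleIntegrable_congr ?_).1 hf.1, ?_⟩
  · rw [abs_of_nonneg hR]; exact h
  · rw [← circleIntegral.integral_congr hR h, hf.2]

end HasCircleIntegral

variable {c R : ℝ}

lemma dist_ofReal_ofReal (s c : ℝ) : dist (s : ℂ) (c : ℂ) = |s - c| := by
  rw [Complex.dist_eq, ← Complex.ofReal_sub, Complex.norm_real, Real.norm_eq_abs]

lemma hasCircleIntegral_inv_of_lt {s : ℝ} (h : |s - c| < R) :
    HasCircleIntegral (fun z => (z - s)⁻¹) c R (2 * π * Complex.I) := by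
  have hR : 0 < R := (abs_nonneg _).trans_lt h
  refine ⟨?_, circleIntegral.integral_sub_inv_of_mem_ball ?_⟩
  · rw [circleIntegrable_sub_inv_iff]
    right
    rw [Metric.mem_sphere, dist_ofReal_ofReal, abs_of_pos hR]
    exact h.ne
  · rw [Metric.mem_ball, dist_ofReal_ofReal]; exact h

lemma hasCircleIntegral_inv_of_gt {s : ℝ} (hR : 0 < R) (h : R < |s - c|) :
    HasCircleIntegral (fun z => (z - s)⁻¹) c R 0 := by
  refine ⟨?_, ?_⟩
  · rw [circleIntegrable_sub_inv_iff]
    right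
    rw [Metric.mem_sphere, dist_ofReal_ofReal, abs_of_pos hR]
    exact h.ne'
  · have hne : ∀ z ∈ Metric.closedBall (c : ℂ) R, z - s ≠ 0 := by
      intro z hz h0
      rw [sub_eq_zero.1 h0, Metric.mem_closedBall, dist_ofReal_ofReal] at hz
      linarith
    apply DiffContOnCl.circleIntegral_eq_zero hR.le
    apply DifferentiableOn.diffContOnCl
    intro z hz
    have := hne z (Metric.closure_ball_subset_closedBall hz)
    apply DifferentiableAt.differentiableWithinAt
    fun_prop (disch := assumption)

lemma sphere_re_ge {z : ℂ} (hz : z ∈ Metric.sphere (c : ℂ) R) : c - R ≤ z.re := by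
  rw [mem_sphere_iff_norm] at hz
  have h1 := (abs_le.1 (Complex.abs_re_le_norm (z - c))).1
  rw [hz] at h1
  simp at h1
  linarith

lemma sphere_norm_sub_ge {z : ℂ} (hz : z ∈ Metric.sphere (c : ℂ) R) (s : ℝ) :
    |R - (|s - c|)| ≤ ‖z - s‖ := by
  have h1 := abs_norm_sub_norm_le (z - c) (s - c)
  rw [mem_sphere_iff_norm] at hz
  rw [hz, ← Complex.ofReal_sub, Complex.norm_real, Real.norm_eq_abs, Complex.ofReal_sub,
    sub_sub_sub_cancel_right] at h1
  exact h1

lemma sphere_sq_sub_sq_ne_zero (hcR : R < c) {z : ℂ} (hz : z ∈ Metric.sphere (c : ℂ) R) {s : ℝ}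
    (hs : 0 ≤ s) (hsR : |s - c| ≠ R) : z ≠ 0 ∧ z - s ≠ 0 ∧ z + s ≠ 0 ∧ z ^ 2 - s ^ 2 ≠ 0 := by
  have h1 := sphere_re_ge hz
  have h2 := sphere_norm_sub_ge hz s
  have hz0 : z ≠ 0 := by
    rintro rfl
    simp at h1
    linarith
  have hzm : z - s ≠ 0 := by
    intro h0
    rw [h0, norm_zero] at h2
    have := abs_nonpos_iff.1 h2
    exact hsR (by linarith)
  have hzp : z + s ≠ 0 := by
    intro h0
    have := congrArg Complex.re h0
    simp at this
    linarith
  refine ⟨hz0, hzm, hzp, ?_⟩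
  rw [show z ^ 2 - (s : ℂ) ^ 2 = (z - s) * (z + s) by ring]
  exact mul_ne_zero hzm hzp

/-- The integrand is `(z - s)⁻¹ / 2 + (z + s)⁻¹ / 2 - z⁻¹`. The circle lies in the open right half
plane, so only the pole `s` can be inside, and its residue `1 / 2` gives `π i`. -/
lemma hasCircleIntegral_partialFraction (hR : 0 < R) (hcR : R < c) {s : ℝ} (hs : 0 ≤ s)
    {P : Prop} [Decidable P] (hin : P → |s - c| < R) (hout : ¬ P → R < |s - c|) :
    HasCircleIntegral (fun z => z / (z ^ 2 - s ^ 2) - z⁻¹) c R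
      (if P then π * Complex.I else 0) := by
  have h0 : HasCircleIntegral (fun z => z⁻¹) c R 0 := by
    have := hasCircleIntegral_inv_of_gt (c := c) (s := 0) hR (by
      rw [zero_sub, abs_neg, abs_of_pos (by linarith)]; exact hcR)
    simpa using this
  have hm : HasCircleIntegral (fun z => (z + s)⁻¹) c R 0 := by
    have := hasCircleIntegral_inv_of_gt (c := c) (s := -s) hR (by
      rw [abs_of_neg (by linarith)]; linarith)
    simpa using this
  have hp : HasCircleIntegral (fun z => (z - s)⁻¹) c R (if P then 2 * π * Complex.I else 0) := by
    split_ifs with hP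
    · exact hasCircleIntegral_inv_of_lt (hin hP)
    · exact hasCircleIntegral_inv_of_gt hR (hout hP)
  have hsR : |s - c| ≠ R := by
    by_cases hP : P
    · exact (hin hP).ne
    · exact (hout hP).ne'
  have := (((hp.const_mul 2⁻¹).add (hm.const_mul 2⁻¹)).sub h0).congr hR.le
    (g := fun z => z / (z ^ 2 - s ^ 2) - z⁻¹) (by
      intro z hz
      obtain ⟨h1, h2, h3, h4⟩ := sphere_sq_sub_sq_ne_zero hcR hz hs hsR
      field_simp
      ring)
  convert this using 1
  split_ifs <;> ring

/-- The integrand is `s⁻¹` times the previous one; this is the source of the factor `1 / σ j` in the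
linear term. -/
lemma hasCircleIntegral_partialFraction' (hR : 0 < R) (hcR : R < c) {s : ℝ} (hs : 0 < s)
    {P : Prop} [Decidable P] (hin : P → |s - c| < R) (hout : ¬ P → R < |s - c|) :
    HasCircleIntegral (fun z => s / (z * (z ^ 2 - s ^ 2))) c R
      ((s : ℂ)⁻¹ * if P then π * Complex.I else 0) := by
  refine ((hasCircleIntegral_partialFraction hR hcR hs.le hin hout).const_mul (s : ℂ)⁻¹).congr
    hR.le fun z hz => ?_
  have hsR : |s - c| ≠ R := by
    by_cases hP : P
    · exact (hin hP).ne
    · exact (hout hP).ne'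
  obtain ⟨h1, h2, h3, h4⟩ := sphere_sq_sub_sq_ne_zero hcR hz hs.le hsR
  have : (s : ℂ) ≠ 0 := by exact_mod_cast hs.ne'
  field_simp
  ring

end CircleIntegrals

/-! ### Spectral projections as contour integrals; second order resolvent expansion -/

section Perturbation

open scoped Matrix.Norms.L2Operator Matrix Real

/-- The circle with centre `c` and radius `R` separates the values with index in `[a, b]`
from the others, with margin `η`. -/
def IsSeparated {r : ℕ} (τ : Fin r → ℝ) (a b : ℕ) (c R η : ℝ) : Prop :=
  ∀ l : Fin r, ((a ≤ (l : ℕ) ∧ (l : ℕ) ≤ b) → |τ l - c| + η ≤ R) ∧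
    (¬ (a ≤ (l : ℕ) ∧ (l : ℕ) ≤ b) → R + η ≤ |τ l - c|)

lemma IsSeparated.le_abs {r : ℕ} {τ : Fin r → ℝ} {a b : ℕ} {c R η : ℝ}
    (h : IsSeparated τ a b c R η) (l : Fin r) : η ≤ |R - (|τ l - c|)| := by
  by_cases hl : a ≤ (l : ℕ) ∧ (l : ℕ) ≤ b
  · have := (h l).1 hl
    exact le_trans (by linarith) (le_abs_self _)
  · have := (h l).2 hl
    exact le_trans (by linarith) (neg_le_abs _)

/-- The bilinear form of the orthogonal projection onto the span of `v a, …, v b`. -/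
noncomputable def blockForm {n r : ℕ} (v : Fin r → EuclideanSpace ℝ (Fin n)) (a b : ℕ)
    (x y : EuclideanSpace ℝ (Fin n)) : ℝ :=
  ∑ l : Block r a b, inner ℝ (v l.1) x * inner ℝ (v l.1) y

lemma sum_block {r : ℕ} {M : Type*} [AddCommMonoid M] (a b : ℕ) (f : Fin r → M) :
    ∑ l : Block r a b, f l.1 = ∑ l : Fin r, if a ≤ (l : ℕ) ∧ (l : ℕ) ≤ b then f l else 0 := by
  rw [← Finset.sum_filter]
  exact (Finset.sum_subtype _ (by simp) f).symm

namespace IsSVD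

variable {p n r : ℕ} {A : Matrix (Fin p) (Fin n) ℝ} {σ : Fin r → ℝ}
  {u : Fin r → EuclideanSpace ℝ (Fin p)} {v : Fin r → EuclideanSpace ℝ (Fin n)}
  {a b : ℕ} {c R η : ℝ}

/-- The positive singular values are handled by the separation. The eigenvalues `0` and `-σ j` are
nonpositive, and the circle stays at distance `c - R ≥ η` to the right of the imaginary axis. -/
lemma resolvent_lower_bound (h : IsSVD A σ u v) (hsep : IsSeparated σ a b c R η) (hη : 0 < η)
    (hcR : R + η ≤ c) {z : ℂ} (hz : z ∈ Metric.sphere (c : ℂ) R)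
    (ξ : EuclideanSpace ℂ (Fin p ⊕ Fin n)) :
    η * ‖ξ‖ ≤ ‖Matrix.toEuclideanCLM (𝕜 := ℂ)
      (z • (1 : Matrix (Fin p ⊕ Fin n) (Fin p ⊕ Fin n) ℂ) - dilation A) ξ‖ := by
  refine norm_sub_apply_ge (dilation_isHermitian A) hη.le (fun l ξ hξ hl => ?_) ξ
  have hre := sphere_re_ge hz
  have hneg : ∀ s : ℝ, s ≤ 0 → η ≤ ‖z - s‖ := by
    intro s hs
    have := Complex.re_le_norm (z - s)
    simp at this
    linarith
  rcases h.eigenvalue_dilation hξ hl with rfl | ⟨j, rfl | rfl⟩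
  · exact hneg 0 le_rfl
  · exact (hsep.le_abs j).trans (sphere_norm_sub_ge hz _)
  · exact hneg _ (by have := h.nonneg j; linarith)

/-- Only block indices contribute. The factor is `π i` instead of `2 π i` because an eigenvector of
the dilation carries half of its squared norm in the `v` component. -/
lemma hasCircleIntegral_resolvent (h : IsSVD A σ u v) (hsep : IsSeparated σ a b c R η) (hη : 0 < η)
    (hR : 0 < R) (hcR : R < c)
    (hu : ∀ z ∈ Metric.sphere (c : ℂ) R,
      IsUnit (z • (1 : Matrix (Fin p ⊕ Fin n) (Fin p ⊕ Fin n) ℂ) - dilation A))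
    (x y : EuclideanSpace ℝ (Fin n)) :
    HasCircleIntegral (fun z => lowerForm
      (z • (1 : Matrix (Fin p ⊕ Fin n) (Fin p ⊕ Fin n) ℂ) - dilation A)⁻¹ x y) c R
      (π * Complex.I * blockForm v a b x y) := by
  have h0 : HasCircleIntegral (fun z => z⁻¹) c R 0 := by
    have := hasCircleIntegral_inv_of_gt (c := c) (s := 0) hR (by
      rw [zero_sub, abs_neg, abs_of_pos (by linarith)]; exact hcR)
    simpa using this
  have hmain := ((HasCircleIntegral.sum Finset.univ fun l _ =>
    (hasCircleIntegral_partialFraction (P := a ≤ (l : ℕ) ∧ (l : ℕ) ≤ b) hR hcR (h.nonneg l)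
      (fun hl => by have := (hsep l).1 hl; linarith)
      (fun hl => by have := (hsep l).2 hl; linarith)).const_mul
        ((inner ℝ (v l) x * inner ℝ (v l) y : ℝ) : ℂ)).add
      (h0.const_mul ((inner ℝ x y : ℝ) : ℂ))).congr hR.le (fun z hz => by
        have hne : ∀ j, z ≠ 0 ∧ z ^ 2 - (σ j : ℂ) ^ 2 ≠ 0 := fun j => by
          have hj : |σ j - c| ≠ R := by
            intro h0
            have := hsep.le_abs j
            rw [h0, sub_self, abs_zero] at this
            linarith
          have := sphere_sq_sub_sq_ne_zero hcR hz (h.nonneg j) hj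
          exact ⟨this.1, this.2.2.2⟩
        have hz0 : z ≠ 0 := by
          rintro rfl
          have := sphere_re_ge hz
          simp at this
          linarith
        exact (h.lowerForm_resolvent hz0 (fun j => (hne j).2) (hu z hz) x y).symm)
  convert hmain using 1
  rw [blockForm, sum_block a b (fun l => inner ℝ (v l) x * inner ℝ (v l) y), mul_zero, add_zero,
    Complex.ofReal_sum, Finset.mul_sum]
  refine Finset.sum_congr rfl fun l _ => ?_
  split_ifs
  · ring
  · simp

lemma hasCircleIntegral_linear (h : IsSVD A σ u v) (hσ : ∀ j, 0 < σ j)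
    (hsep : IsSeparated σ a b c R η) (hη : 0 < η) (hR : 0 < R) (hcR : R < c)
    (hu : ∀ z ∈ Metric.sphere (c : ℂ) R,
      IsUnit (z • (1 : Matrix (Fin p ⊕ Fin n) (Fin p ⊕ Fin n) ℂ) - dilation A))
    (D : Matrix (Fin p) (Fin n) ℝ) (x y : EuclideanSpace ℝ (Fin n))
    (hx : ∀ j, inner ℝ (v j) x = 0) :
    HasCircleIntegral (fun z => lowerForm
      ((z • (1 : Matrix (Fin p ⊕ Fin n) (Fin p ⊕ Fin n) ℂ) - dilation A)⁻¹ * dilation D *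
        (z • (1 : Matrix (Fin p ⊕ Fin n) (Fin p ⊕ Fin n) ℂ) - dilation A)⁻¹) x y) c R
      (π * Complex.I * (∑ l : Block r a b,
        (σ l.1)⁻¹ * (inner ℝ (u l.1) (Matrix.toEuclideanLin D x) * inner ℝ (v l.1) y) : ℝ)) := by
  have hmain := (HasCircleIntegral.sum Finset.univ fun l _ =>
    (hasCircleIntegral_partialFraction' (P := a ≤ (l : ℕ) ∧ (l : ℕ) ≤ b) hR hcR (hσ l)
      (fun hl => by have := (hsep l).1 hl; linarith)
      (fun hl => by have := (hsep l).2 hl; linarith)).const_mul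
        ((inner ℝ (u l) (Matrix.toEuclideanLin D x) * inner ℝ (v l) y : ℝ) : ℂ)).congr hR.le
      (fun z hz => by
        have hne : ∀ j, z ≠ 0 ∧ z ^ 2 - (σ j : ℂ) ^ 2 ≠ 0 := fun j => by
          have hj : |σ j - c| ≠ R := by
            intro h0
            have := hsep.le_abs j
            rw [h0, sub_self, abs_zero] at this
            linarith
          have := sphere_sq_sub_sq_ne_zero hcR hz (h.nonneg j) hj
          exact ⟨this.1, this.2.2.2⟩
        have hz0 : z ≠ 0 := by
          rintro rfl
          have := sphere_re_ge hz
          simp at this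
          linarith
        exact (h.lowerForm_resolvent_dilation_resolvent hz0 (fun j => (hne j).2) (hu z hz)
          D x y hx).symm)
  convert hmain using 1
  rw [sum_block a b (fun l => (σ l)⁻¹ *
    (inner ℝ (u l) (Matrix.toEuclideanLin D x) * inner ℝ (v l) y)), Complex.ofReal_sum,
    Finset.mul_sum]
  refine Finset.sum_congr rfl fun l _ => ?_
  split_ifs
  · push_cast; ring
  · simp

end IsSVD

/-- The difference of two second order remainders of the resolvent expansion. -/
lemma norm_resolvent_remainder_sub_le {ι : Type*} [Fintype ι] [DecidableEq ι]
    {B X Y : Matrix ι ι ℂ} {g δ d : ℝ} (hg : 0 < g) (hδ : δ ≤ g / 4)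
    (hB : IsUnit B) (hBX : IsUnit (B - X)) (hBY : IsUnit (B - Y))
    (nB : ‖B⁻¹‖ ≤ 2 / g) (nBX : ‖(B - X)⁻¹‖ ≤ 4 / g) (nBY : ‖(B - Y)⁻¹‖ ≤ 4 / g)
    (nX : ‖X‖ ≤ δ) (nY : ‖Y‖ ≤ δ) (nXY : ‖X - Y‖ ≤ d) :
    ‖(B - X)⁻¹ - (B - Y)⁻¹ - B⁻¹ * (X - Y) * B⁻¹‖ ≤ 48 * δ * d / g ^ 3 := by
  have hδ0 : 0 ≤ δ := (norm_nonneg _).trans nX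
  have hd0 : 0 ≤ d := (norm_nonneg _).trans nXY
  have hdet : ∀ {C : Matrix ι ι ℂ}, IsUnit C → C⁻¹ * C = 1 ∧ C * C⁻¹ = 1 := fun hC =>
    ⟨Matrix.nonsing_inv_mul _ ((Matrix.isUnit_iff_isUnit_det _).1 hC),
      Matrix.mul_nonsing_inv _ ((Matrix.isUnit_iff_isUnit_det _).1 hC)⟩
  obtain ⟨b1, b2⟩ := hdet hB
  obtain ⟨x1, x2⟩ := hdet hBX
  obtain ⟨y1, y2⟩ := hdet hBY
  set P := B⁻¹
  set S := (B - X)⁻¹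
  set T := (B - Y)⁻¹
  have e1 : ∀ (Z Q : Matrix ι ι ℂ), (B - Z) * Q = 1 → Q = P + P * Z * Q := by
    intro Z Q hQ
    calc Q = P * (B * Q) := by rw [← mul_assoc, b1, one_mul]
      _ = P * ((B - Z) * Q + Z * Q) := by rw [sub_mul, sub_add_cancel]
      _ = _ := by rw [hQ, mul_add, mul_one, mul_assoc]
  have eS := e1 X S x2
  have eT := e1 Y T y2
  have eST : S - T = S * (X - Y) * T := by
    calc S - T = S * ((B - Y) * T) - (S * (B - X)) * T := by rw [y2, x1, mul_one, one_mul]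
      _ = _ := by noncomm_ring
  have hexp : ∀ (Z Q : Matrix ι ι ℂ), Q = P + P * Z * Q →
      Q - P - P * Z * P = P * Z * P * Z * Q := by
    intro Z Q hQ
    have h2 : P * Z * Q = P * Z * (P + P * Z * Q) := by rw [← hQ]
    calc Q - P - P * Z * P = P * Z * Q - P * Z * P := by nth_rewrite 1 [hQ]; abel
      _ = P * Z * (P + P * Z * Q) - P * Z * P := by rw [← h2]
      _ = _ := by noncomm_ring
  -- The quadratic remainders `P X P X S` and `P Y P Y T` are subtracted by changing one factor at a
  -- time, so that each term contains `X - Y` and at least one further small factor.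
  have hid : S - T - P * (X - Y) * P
      = P * (X - Y) * P * X * S + P * Y * P * (X - Y) * S + P * Y * P * Y * (S * (X - Y) * T) := by
    rw [← eST]
    calc S - T - P * (X - Y) * P
        = (S - P - P * X * P) - (T - P - P * Y * P) := by noncomm_ring
      _ = P * X * P * X * S - P * Y * P * Y * T := by rw [hexp X S eS, hexp Y T eT]
      _ = _ := by noncomm_ring
  have n1 : ‖P * (X - Y) * P * X * S‖ ≤ 2 / g * d * (2 / g) * δ * (4 / g) :=
    norm_mul_le_of_le (norm_mul_le_of_le (norm_mul_le_of_le
      (norm_mul_le_of_le nB nXY) nB) nX) nBX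
  have n2 : ‖P * Y * P * (X - Y) * S‖ ≤ 2 / g * δ * (2 / g) * d * (4 / g) :=
    norm_mul_le_of_le (norm_mul_le_of_le (norm_mul_le_of_le
      (norm_mul_le_of_le nB nY) nB) nXY) nBX
  have n3 : ‖P * Y * P * Y * (S * (X - Y) * T)‖
      ≤ 2 / g * δ * (2 / g) * δ * (4 / g * d * (4 / g)) :=
    norm_mul_le_of_le (norm_mul_le_of_le (norm_mul_le_of_le
      (norm_mul_le_of_le nB nY) nB) nY) (norm_mul_le_of_le (norm_mul_le_of_le nBX nXY) nBY)
  rw [hid]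
  refine (norm_add₃_le).trans ((add_le_add (add_le_add n1 n2) n3).trans ?_)
  -- This term carries an extra `δ`; `δ ≤ g / 4` brings it to the order of the other two, and `16 +
  -- 16 + 16 = 48`.
  have h3 : 2 / g * δ * (2 / g) * δ * (4 / g * d * (4 / g)) ≤ 16 * δ * d / g ^ 3 := by
    calc _ = 64 * δ * d / g ^ 4 * δ := by field_simp; ring
      _ ≤ 64 * δ * d / g ^ 4 * (g / 4) := by gcongr
      _ = _ := by field_simp; ring
  have h1 : 2 / g * d * (2 / g) * δ * (4 / g) + 2 / g * δ * (2 / g) * d * (4 / g)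
      = 32 * δ * d / g ^ 3 := by field_simp; ring
  calc _ ≤ 32 * δ * d / g ^ 3 + 16 * δ * d / g ^ 3 := by linarith
    _ = _ := by ring

end Perturbation

/-! ### The separating circle -/

section Separation

variable {k : ℕ}

/-- A finite sequence extended by `0`. -/
noncomputable def extendZero (σ : Fin k → ℝ) (l : ℕ) : ℝ := if h : l < k then σ ⟨l, h⟩ else 0

lemma extendZero_antitone {σ : Fin k → ℝ} (hσ : Antitone σ) (h0 : ∀ j, 0 ≤ σ j) :
    Antitone (extendZero σ) := by
  intro i j hij
  unfold extendZero
  split_ifs with h1 h2 h2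
  · exact hσ hij
  · omega
  · exact h0 _
  · exact le_rfl

lemma extendZero_coe (σ : Fin k → ℝ) (l : Fin k) : extendZero σ l = σ l := by
  simp [extendZero]

lemma lowerGap_eq (σ : Fin k → ℝ) (b : Fin k) :
    lowerGap σ b = σ b - extendZero σ ((b : ℕ) + 1) := rfl

lemma gap_le_lowerGap (σ : Fin k → ℝ) (a b : Fin k) : gap σ a b ≤ lowerGap σ b := by
  unfold gap
  split_ifs
  · exact le_rfl
  · exact min_le_right _ _

/-- This keeps the separating circle in the right half plane: `R + g / 2 ≤ c` amounts to `g ≤ σ b`.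
-/
lemma gap_le {σ : Fin k → ℝ} (h0 : ∀ j, 0 ≤ σ j) (a b : Fin k) : gap σ a b ≤ σ b := by
  refine (gap_le_lowerGap σ a b).trans ?_
  rw [lowerGap_eq]
  have : 0 ≤ extendZero σ ((b : ℕ) + 1) := by
    unfold extendZero
    split_ifs
    · exact h0 _
    · exact le_rfl
  linarith

/-- The circle is centred at the middle of the block, and its radius is half the width of the block
plus half the gap. Unperturbed values are thus at distance at least `gap / 2` from it on either
side, and moving them by `ε` costs `ε`. -/
lemma isSeparated_of_gap {σ : Fin k → ℝ} (hσ : Antitone σ) (h0 : ∀ j, 0 ≤ σ j) {a b : Fin k}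
    {r : ℕ} {τ : Fin r → ℝ} {ε : ℝ} (hτ : ∀ l : Fin r, |τ l - extendZero σ l| ≤ ε) :
    IsSeparated τ a b ((σ a + σ b) / 2) ((σ a - σ b + gap σ a b) / 2) (gap σ a b / 2 - ε) := by
  have hext := extendZero_antitone hσ h0
  intro l
  have hl := abs_le.1 (hτ l)
  refine ⟨fun hb => ?_, fun hb => ?_⟩
  · have h1 := hext hb.1
    have h2 := hext hb.2
    rw [extendZero_coe] at h1 h2
    have : |τ l - (σ a + σ b) / 2| ≤ (σ a - σ b) / 2 + ε := abs_le.2 ⟨by linarith, by linarith⟩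
    linarith
  · rw [not_and_or, not_le, not_le] at hb
    rcases hb with hb | hb
    · have ha0 : (a : ℕ) ≠ 0 := by omega
      have h1 : (l : ℕ) ≤ (a : ℕ) - 1 := by omega
      have h2 := hext h1
      have h3 : extendZero σ ((a : ℕ) - 1)
          = σ ⟨(a : ℕ) - 1, lt_of_le_of_lt (Nat.sub_le _ _) a.isLt⟩ := by
        have : (a : ℕ) - 1 < k := lt_of_le_of_lt (Nat.sub_le _ _) a.isLt
        simp [extendZero, this]
      have h4 : gap σ a b ≤ extendZero σ ((a : ℕ) - 1) - σ a := by
        rw [h3, gap, if_neg ha0]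
        exact min_le_left _ _
      refine le_trans ?_ (le_abs_self _)
      linarith
    · have h1 : (b : ℕ) + 1 ≤ l := hb
      have h2 := hext h1
      have h3 := gap_le_lowerGap σ a b
      rw [lowerGap_eq] at h3
      refine le_trans ?_ (neg_le_abs _)
      linarith

/-- Weyl's inequality in both directions. Beyond index `k` the lower bound is just nonnegativity of
`τ l`. -/
lemma IsSVD.abs_sub_extendZero_le {p n r : ℕ} {M E : Matrix (Fin p) (Fin n) ℝ} {σ : Fin k → ℝ}
    {u : Fin k → EuclideanSpace ℝ (Fin p)} {v : Fin k → EuclideanSpace ℝ (Fin n)}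
    {τ : Fin r → ℝ} {u' : Fin r → EuclideanSpace ℝ (Fin p)} {v' : Fin r → EuclideanSpace ℝ (Fin n)}
    (hM : IsSVD M σ u v) (hE : IsSVD (M + E) τ u' v') (l : Fin r) :
    |τ l - extendZero σ l| ≤ opNorm E := by
  have h1 := hE.weyl hM l
  rw [add_sub_cancel_left] at h1
  change τ l ≤ extendZero σ l + opNorm E at h1
  rw [abs_le]
  refine ⟨?_, by linarith⟩
  by_cases hl : (l : ℕ) < k
  · have h2 := hM.weyl hE ⟨l, hl⟩
    rw [dif_pos l.isLt, opNorm_sub_comm, add_sub_cancel_left] at h2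
    simp only [extendZero, dif_pos hl]
    linarith
  · simp only [extendZero, dif_neg hl]
    have := hE.nonneg l
    have := opNorm_nonneg E
    linarith

end Separation

/-! ### Comparison of the projections of two perturbations -/

section Perturbation

open scoped Matrix.Norms.L2Operator Matrix Real

variable {p n k r r' : ℕ} {M E F : Matrix (Fin p) (Fin n) ℝ} {σ : Fin k → ℝ}
  {u : Fin k → EuclideanSpace ℝ (Fin p)} {v : Fin k → EuclideanSpace ℝ (Fin n)}
  {τ : Fin r → ℝ} {u₁ : Fin r → EuclideanSpace ℝ (Fin p)} {v₁ : Fin r → EuclideanSpace ℝ (Fin n)}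
  {ρ : Fin r' → ℝ} {u₂ : Fin r' → EuclideanSpace ℝ (Fin p)}
  {v₂ : Fin r' → EuclideanSpace ℝ (Fin n)}

/-- The resolvent of a perturbed dilation on the separating circle. -/
lemma IsSVD.resolvent_perturbed (hM : IsSVD M σ u v) {a b : ℕ} {c R g δ : ℝ} (hg : 0 < g)
    (hsep : IsSeparated σ a b c R (g / 2)) (hcR : R + g / 2 ≤ c) (hE : opNorm E ≤ δ)
    (hδ : δ ≤ g / 4) {z : ℂ} (hz : z ∈ Metric.sphere (c : ℂ) R) :
    IsUnit (z • (1 : Matrix (Fin p ⊕ Fin n) (Fin p ⊕ Fin n) ℂ) - dilation M - dilation E) ∧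
    ‖(z • (1 : Matrix (Fin p ⊕ Fin n) (Fin p ⊕ Fin n) ℂ) - dilation M - dilation E)⁻¹‖
      ≤ 4 / g := by
  -- The unperturbed lower bound `g / 2` loses at most `‖dilation E‖ ≤ g / 4`.
  have h := isUnit_and_norm_inv_le (B := z • (1 : Matrix (Fin p ⊕ Fin n) (Fin p ⊕ Fin n) ℂ)
    - dilation M - dilation E) (d := g / 4) (by positivity) (fun ξ => by
      have h1 := hM.resolvent_lower_bound hsep (by positivity) hcR hz ξ
      have h2 := (Matrix.toEuclideanCLM (𝕜 := ℂ) (dilation E)).le_opNorm ξ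
      rw [← Matrix.cstar_norm_def] at h2
      have h3 : ‖dilation E‖ ≤ g / 4 := (norm_dilation_le E).trans (hE.trans hδ)
      have h4 : ‖dilation E‖ * ‖ξ‖ ≤ g / 4 * ‖ξ‖ := by gcongr
      rw [map_sub, sub_apply]
      have h5 := norm_sub_norm_le (Matrix.toEuclideanCLM (𝕜 := ℂ)
        (z • (1 : Matrix (Fin p ⊕ Fin n) (Fin p ⊕ Fin n) ℂ) - dilation M) ξ)
        (Matrix.toEuclideanCLM (𝕜 := ℂ) (dilation E) ξ)
      linarith)
  rwa [inv_div] at h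

/-- Comparison of the spectral projections of two perturbations of the same matrix, after
subtracting the linear term. -/
lemma IsSVD.abs_blockForm_sub_le (hM : IsSVD M σ u v) (hσ : ∀ j, 0 < σ j)
    (hE : IsSVD (M + E) τ u₁ v₁) (hF : IsSVD (M + F) ρ u₂ v₂) {a b : ℕ} {c R g δ : ℝ}
    (hg : 0 < g) (hR : 0 < R) (hcR : R + g / 2 ≤ c) (hδ : δ ≤ g / 4)
    (hEδ : opNorm E ≤ δ) (hFδ : opNorm F ≤ δ)
    (sM : IsSeparated σ a b c R (g / 2)) (sE : IsSeparated τ a b c R (g / 4))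
    (sF : IsSeparated ρ a b c R (g / 4)) (x y : EuclideanSpace ℝ (Fin n))
    (hx : ∀ j, inner ℝ (v j) x = 0) :
    |blockForm v₁ a b x y - blockForm v₂ a b x y - ∑ l : Block k a b,
        (σ l.1)⁻¹ * (inner ℝ (u l.1) (Matrix.toEuclideanLin (E - F) x) * inner ℝ (v l.1) y)|
      ≤ 96 * R * δ * opNorm (E - F) / g ^ 3 * ‖x‖ * ‖y‖ := by
  have hE' : ∀ z : ℂ, z • (1 : Matrix (Fin p ⊕ Fin n) (Fin p ⊕ Fin n) ℂ) - dilation (M + E)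
      = z • (1 : Matrix (Fin p ⊕ Fin n) (Fin p ⊕ Fin n) ℂ) - dilation M - dilation E := fun z => by
    rw [dilation_add, sub_sub]
  have hF' : ∀ z : ℂ, z • (1 : Matrix (Fin p ⊕ Fin n) (Fin p ⊕ Fin n) ℂ) - dilation (M + F)
      = z • (1 : Matrix (Fin p ⊕ Fin n) (Fin p ⊕ Fin n) ℂ) - dilation M - dilation F := fun z => by
    rw [dilation_add, sub_sub]
  have hB : ∀ z ∈ Metric.sphere (c : ℂ) R,
      IsUnit (z • (1 : Matrix (Fin p ⊕ Fin n) (Fin p ⊕ Fin n) ℂ) - dilation M) ∧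
      ‖(z • (1 : Matrix (Fin p ⊕ Fin n) (Fin p ⊕ Fin n) ℂ) - dilation M)⁻¹‖ ≤ 2 / g := by
    intro z hz
    have := isUnit_and_norm_inv_le (d := g / 2) (by positivity)
      (hM.resolvent_lower_bound sM (by positivity) hcR hz)
    rwa [inv_div] at this
  have hcR' : R < c := by linarith
  have i1 := hE.hasCircleIntegral_resolvent sE (by positivity) hR hcR' (fun z hz => by
    rw [hE']; exact (hM.resolvent_perturbed hg sM hcR hEδ hδ hz).1) x y
  have i2 := hF.hasCircleIntegral_resolvent sF (by positivity) hR hcR' (fun z hz => by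
    rw [hF']; exact (hM.resolvent_perturbed hg sM hcR hFδ hδ hz).1) x y
  have i3 := hM.hasCircleIntegral_linear hσ sM (by positivity) hR hcR' (fun z hz => (hB z hz).1)
    (E - F) x y hx
  have hI := ((i1.sub i2).sub i3).2
  rw [← mul_sub, ← mul_sub, ← Complex.ofReal_sub, ← Complex.ofReal_sub] at hI
  set Φ : ℝ := blockForm v₁ a b x y - blockForm v₂ a b x y - ∑ l : Block k a b,
    (σ l.1)⁻¹ * (inner ℝ (u l.1) (Matrix.toEuclideanLin (E - F) x) * inner ℝ (v l.1) y) with hΦ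
  -- Length of the circle times the pointwise bound. Dividing `2 π R * 48` by the `π` on the left
  -- gives the constant `96 R`.
  have hbound : ‖π * Complex.I * (Φ : ℂ)‖
      ≤ 2 * π * R * (48 * δ * opNorm (E - F) / g ^ 3 * ‖x‖ * ‖y‖) := by
      rw [← hI]
      refine circleIntegral.norm_integral_le_of_norm_le_const hR.le fun z hz => ?_
      rw [hE', hF', ← lowerForm_sub, ← lowerForm_sub, dilation_sub]
      refine (norm_lowerForm_le _ x y).trans ?_
      gcongr
      obtain ⟨u1, n1⟩ := hB z hz
      obtain ⟨u2, n2⟩ := hM.resolvent_perturbed hg sM hcR hEδ hδ hz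
      obtain ⟨u3, n3⟩ := hM.resolvent_perturbed hg sM hcR hFδ hδ hz
      refine norm_resolvent_remainder_sub_le hg hδ u1 u2 u3 n1 n2 n3
        ((norm_dilation_le E).trans hEδ) ((norm_dilation_le F).trans hFδ) ?_
      rw [← dilation_sub]
      exact norm_dilation_le _
  rw [norm_mul, norm_mul, Complex.norm_I, Complex.norm_real, Complex.norm_real, mul_one,
    Real.norm_of_nonneg Real.pi_pos.le, Real.norm_eq_abs] at hbound
  have hpi := Real.pi_pos
  refine le_of_mul_le_mul_left (hbound.trans (le_of_eq ?_)) hpi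
  ring

end Perturbation

/-! ### The remainder as a bilinear form, and its bounds -/

section Remainder

open scoped Matrix

lemma toEuclideanLin_mul_apply {l m n : Type*} [Fintype m] [Fintype n] [DecidableEq m]
    [DecidableEq n] (A : Matrix l m ℝ) (B : Matrix m n ℝ) (y : EuclideanSpace ℝ n) :
    Matrix.toEuclideanLin (A * B) y = Matrix.toEuclideanLin A (Matrix.toEuclideanLin B y) := by
  simp [Matrix.toLpLin_apply]

lemma inner_toEuclideanLin_transpose {m n : Type*} [Fintype m] [Fintype n] [DecidableEq m]
    [DecidableEq n] (A : Matrix m n ℝ) (x : EuclideanSpace ℝ m) (y : EuclideanSpace ℝ n) :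
    inner ℝ x (Matrix.toEuclideanLin A y) = inner ℝ (Matrix.toEuclideanLin A.transpose x) y := by
  rw [inner_toEuclideanLin_eq_sum, real_inner_comm, inner_toEuclideanLin_eq_sum, Finset.sum_comm]
  exact Finset.sum_congr rfl fun i _ => Finset.sum_congr rfl fun j _ => by
    simp only [Matrix.transpose_apply]; ring

lemma toEuclideanLin_columns {m ι : Type*} [Fintype m] [Fintype ι] [DecidableEq ι]
    (w : ι → EuclideanSpace ℝ m) (c : EuclideanSpace ℝ ι) :
    Matrix.toEuclideanLin (Matrix.of fun i j => w j i) c = ∑ j, c j • w j := by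
  ext i
  simp [Matrix.toLpLin_apply, Matrix.mulVec, dotProduct, mul_comm]

lemma toEuclideanLin_columns_transpose {m ι : Type*} [Fintype m] [DecidableEq m] [Fintype ι]
    (w : ι → EuclideanSpace ℝ m) (x : EuclideanSpace ℝ m) (j : ι) :
    Matrix.toEuclideanLin (Matrix.of fun i j => w j i).transpose x j = inner ℝ (w j) x := by
  simp [Matrix.toLpLin_apply, Matrix.mulVec, dotProduct, PiLp.inner_apply, mul_comm]

/-- The projection of `x` onto the orthogonal complement of the span of the `v j`. -/
noncomputable def complProj {n k : ℕ} (v : Fin k → EuclideanSpace ℝ (Fin n))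
    (x : EuclideanSpace ℝ (Fin n)) : EuclideanSpace ℝ (Fin n) :=
  x - ∑ j, inner ℝ (v j) x • v j

/-- The combination of the vectors `v a, …, v b` with coefficients `c`. -/
noncomputable def blockComb {n k : ℕ} (v : Fin k → EuclideanSpace ℝ (Fin n)) {a b : ℕ}
    (c : EuclideanSpace ℝ (Block k a b)) : EuclideanSpace ℝ (Fin n) :=
  ∑ j : Block k a b, c j • v j.1

variable {p n k r : ℕ}

lemma inner_complProj {v : Fin k → EuclideanSpace ℝ (Fin n)} (hv : Orthonormal ℝ v)
    (x : EuclideanSpace ℝ (Fin n)) (j : Fin k) : inner ℝ (v j) (complProj v x) = 0 := by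
  rw [complProj, inner_sub_right, hv.inner_right_fintype, sub_self]

lemma norm_complProj_le {v : Fin k → EuclideanSpace ℝ (Fin n)} (hv : Orthonormal ℝ v)
    (x : EuclideanSpace ℝ (Fin n)) : ‖complProj v x‖ ≤ ‖x‖ := by
  have h1 : inner ℝ (complProj v x) (complProj v x) = inner ℝ (complProj v x) x := by
    nth_rewrite 2 [complProj]
    rw [inner_sub_right, inner_sum]
    simp [inner_smul_right, real_inner_comm, inner_complProj hv]
  have h2 := real_inner_le_norm (complProj v x) x
  rw [← h1, real_inner_self_eq_norm_sq] at h2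
  nlinarith [norm_nonneg (complProj v x), norm_nonneg x]

lemma norm_blockComb {v : Fin k → EuclideanSpace ℝ (Fin n)} (hv : Orthonormal ℝ v) {a b : ℕ}
    (c : EuclideanSpace ℝ (Block k a b)) : ‖blockComb v c‖ = ‖c‖ := by
  have hv' : Orthonormal ℝ fun j : Block k a b => v j.1 := hv.comp _ Subtype.val_injective
  rw [← sq_eq_sq₀ (norm_nonneg _) (norm_nonneg _), ← real_inner_self_eq_norm_sq,
    blockComb, hv'.inner_sum, EuclideanSpace.real_norm_sq_eq]
  simp [sq]

lemma inner_projection_eq_blockForm (w : Fin r → EuclideanSpace ℝ (Fin n)) (a b : ℕ)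
    (x y : EuclideanSpace ℝ (Fin n)) :
    inner ℝ x (Matrix.toEuclideanLin (blockMatrix w a b * (blockMatrix w a b).transpose) y)
      = blockForm w a b x y := by
  rw [toEuclideanLin_mul_apply, inner_toEuclideanLin_transpose, PiLp.inner_apply, blockForm]
  refine Finset.sum_congr rfl fun j _ => ?_
  rw [blockMatrix, toEuclideanLin_columns_transpose (fun j : Block r a b => w j.1),
    toEuclideanLin_columns_transpose (fun j : Block r a b => w j.1)]
  simp [mul_comm]

/-- Moving `I - V Vᵀ` onto `x` makes it orthogonal to all `v j`. This kills the unperturbed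
projection and puts the form where the contour formula for the linear term applies. -/
lemma inner_remainder (σ : Fin k → ℝ) (u : Fin k → EuclideanSpace ℝ (Fin p))
    {v : Fin k → EuclideanSpace ℝ (Fin n)} (hv : Orthonormal ℝ v)
    (a b : Fin k) (E : Matrix (Fin p) (Fin n) ℝ) (v' : Fin r → EuclideanSpace ℝ (Fin n))
    (x : EuclideanSpace ℝ (Fin n)) (c : EuclideanSpace ℝ (Block k a b)) :
    inner ℝ x (Matrix.toEuclideanLin (remainder σ u v a b E v') c)
      = blockForm v' a b (complProj v x) (blockComb v c)
        - ∑ l : Block k a b, (σ l.1)⁻¹ *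
          (inner ℝ (u l.1) (Matrix.toEuclideanLin E (complProj v x))
            * inner ℝ (v l.1) (blockComb v c)) := by
  have hQt : (1 - colMatrix v * (colMatrix v).transpose).transpose
      = 1 - colMatrix v * (colMatrix v).transpose := by
    rw [Matrix.transpose_sub, Matrix.transpose_mul, Matrix.transpose_transpose,
      Matrix.transpose_one]
  have hQ : Matrix.toEuclideanLin (1 - colMatrix v * (colMatrix v).transpose) x
      = complProj v x := by
    rw [map_sub, LinearMap.sub_apply, toEuclideanLin_mul_apply, complProj, colMatrix,
      toEuclideanLin_columns v]
    simp only [toEuclideanLin_columns_transpose v]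
    simp
  have hV : Matrix.toEuclideanLin (blockMatrix v a b) c = blockComb v c :=
    toEuclideanLin_columns (fun j : Block k a b => v j.1) c
  have h0 : blockForm v a b (complProj v x) (blockComb v c) = 0 := by
    simp [blockForm, inner_complProj hv]
  rw [remainder, map_sub, LinearMap.sub_apply, inner_sub_right, map_sum, LinearMap.sum_apply,
    inner_sum]
  congr 1
  · rw [toEuclideanLin_mul_apply, toEuclideanLin_mul_apply, hV, inner_toEuclideanLin_transpose,
      hQt, hQ, map_sub, LinearMap.sub_apply, inner_sub_right, inner_projection_eq_blockForm,
      inner_projection_eq_blockForm, h0, sub_zero]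
  · refine Finset.sum_congr rfl fun l _ => ?_
    rw [map_smul, LinearMap.smul_apply, inner_smul_right, toEuclideanLin_mul_apply, hV,
      toEuclideanLin_mul_apply, toEuclideanLin_mul_apply, inner_toEuclideanLin_transpose, hQt, hQ,
      inner_toEuclideanLin_transpose, Matrix.transpose_transpose]
    have : Matrix.toEuclideanLin (Matrix.vecMulVec (u l.1) (v l.1)) (blockComb v c)
        = inner ℝ (v l.1) (blockComb v c) • u l.1 := by
      have := toEuclideanLin_sum_smul_vecMulVec (ι := Unit) (fun _ => 1) (fun _ => u l.1)
        (fun _ => v l.1) (blockComb v c)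
      simpa using this
    rw [this, inner_smul_right, real_inner_comm (u l.1), one_div]
    ring

lemma sum_mul_le_of_sum_sq_le {ι : Type*} [Fintype ι] {f g : ι → ℝ} {A B : ℝ} (hA : 0 ≤ A)
    (hB : 0 ≤ B) (hf : ∑ i, f i ^ 2 ≤ A ^ 2) (hg : ∑ i, g i ^ 2 ≤ B ^ 2) :
    |∑ i, f i * g i| ≤ A * B := by
  apply abs_le_of_sq_le_sq _ (by positivity)
  calc _ ≤ (∑ i, f i ^ 2) * ∑ i, g i ^ 2 := Finset.sum_mul_sq_le_sq_mul_sq _ _ _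
    _ ≤ A ^ 2 * B ^ 2 := by gcongr
    _ = _ := by ring

lemma sum_inner_block_sq_le {m : ℕ} {w : Fin r → EuclideanSpace ℝ (Fin m)} (hw : Orthonormal ℝ w)
    (a b : ℕ) (x : EuclideanSpace ℝ (Fin m)) :
    ∑ l : Block r a b, (inner ℝ (w l.1) x) ^ 2 ≤ ‖x‖ ^ 2 := by
  have hw' : Orthonormal ℝ fun j : Block r a b => w j.1 := hw.comp _ Subtype.val_injective
  simpa using hw'.sum_inner_products_le (s := Finset.univ) x

/-- A crude bound with no smallness of `E`, for the regime where the gap is small against the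
deviation level. Bessel's inequality bounds the projection form by `1`, and `σ l ≥ σ b ≥ gap` on the
block bounds the linear term. -/
lemma opNorm_remainder_le {M E : Matrix (Fin p) (Fin n) ℝ} {σ : Fin k → ℝ}
    {u : Fin k → EuclideanSpace ℝ (Fin p)} {v : Fin k → EuclideanSpace ℝ (Fin n)}
    (hM : IsSVD M σ u v) {a b : Fin k} (hg : 0 < gap σ a b)
    {v' : Fin r → EuclideanSpace ℝ (Fin n)} (hv' : Orthonormal ℝ v') :
    opNorm (remainder σ u v a b E v') ≤ 1 + opNorm E / gap σ a b := by
  have hE0 := opNorm_nonneg E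
  refine opNorm_le_of_inner_le (by positivity) fun x c => ?_
  rw [inner_remainder σ u hM.orthonormal_right]
  set x' := complProj v x
  set y := blockComb v c
  have hx' : ‖x'‖ ≤ ‖x‖ := norm_complProj_le hM.orthonormal_right x
  have hy : ‖y‖ = ‖c‖ := norm_blockComb hM.orthonormal_right c
  have h1 : |blockForm v' a b x' y| ≤ ‖x‖ * ‖c‖ := by
    rw [← hy]
    exact sum_mul_le_of_sum_sq_le (norm_nonneg _) (norm_nonneg _)
      ((sum_inner_block_sq_le hv' a b x').trans (by gcongr)) (sum_inner_block_sq_le hv' a b y)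
  have h2 : |∑ l : Block k a b, (σ l.1)⁻¹ * (inner ℝ (u l.1) (Matrix.toEuclideanLin E x')
      * inner ℝ (v l.1) y)| ≤ (opNorm E * ‖x‖) * ((gap σ a b)⁻¹ * ‖c‖) := by
    have h3 : ∑ l : Block k a b, ((σ l.1)⁻¹ * inner ℝ (v l.1) y) ^ 2
        ≤ ((gap σ a b)⁻¹ * ‖c‖) ^ 2 := by
      calc _ ≤ ∑ l : Block k a b, (gap σ a b)⁻¹ ^ 2 * (inner ℝ (v l.1) y) ^ 2 := by
            refine Finset.sum_le_sum fun l _ => ?_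
            rw [mul_pow]
            have h4 : gap σ a b ≤ σ l.1 := (gap_le hM.nonneg a b).trans (hM.antitone l.2.2)
            have h5 : 0 < σ l.1 := hg.trans_le h4
            gcongr
        _ ≤ _ := by
            rw [← Finset.mul_sum, mul_pow, ← hy]
            gcongr
            exact sum_inner_block_sq_le hM.orthonormal_right a b y
    have h4 : ∑ l : Block k a b, (inner ℝ (u l.1) (Matrix.toEuclideanLin E x')) ^ 2
        ≤ (opNorm E * ‖x‖) ^ 2 := by
      refine (sum_inner_block_sq_le hM.orthonormal_left a b _).trans ?_
      gcongr
      refine (norm_toEuclideanLin_le E x').trans ?_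
      gcongr
    have := sum_mul_le_of_sum_sq_le (by positivity) (by positivity) h4 h3
    refine le_trans (le_of_eq ?_) this
    congr 1
    exact Finset.sum_congr rfl fun l _ => by ring
  have h3 := le_abs_self (blockForm v' a b x' y)
  have h4 := neg_abs_le (∑ l : Block k a b, (σ l.1)⁻¹ *
    (inner ℝ (u l.1) (Matrix.toEuclideanLin E x') * inner ℝ (v l.1) y))
  calc _ ≤ ‖x‖ * ‖c‖ + (opNorm E * ‖x‖) * ((gap σ a b)⁻¹ * ‖c‖) := by linarith
    _ = _ := by ring

/-- On the set of small perturbations the remainder is Lipschitz. -/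
lemma opNorm_remainder_sub_le {M E F : Matrix (Fin p) (Fin n) ℝ} {σ : Fin k → ℝ}
    {u : Fin k → EuclideanSpace ℝ (Fin p)} {v : Fin k → EuclideanSpace ℝ (Fin n)}
    (hM : IsSVD M σ u v) (hσ : ∀ j, 0 < σ j) {a b : Fin k} (hab : a ≤ b) (hg : 0 < gap σ a b)
    {τ ρ : Fin r → ℝ} {u₁ u₂ : Fin r → EuclideanSpace ℝ (Fin p)}
    {v₁ v₂ : Fin r → EuclideanSpace ℝ (Fin n)}
    (hE : IsSVD (M + E) τ u₁ v₁) (hF : IsSVD (M + F) ρ u₂ v₂) {δ : ℝ}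
    (hδ : δ ≤ gap σ a b / 4) (hEδ : opNorm E ≤ δ) (hFδ : opNorm F ≤ δ) :
    opNorm (remainder σ u v a b E v₁ - remainder σ u v a b F v₂)
      ≤ 48 * (1 + (σ a - σ b) / gap σ a b) * δ / gap σ a b ^ 2 * opNorm (E - F) := by
  set g := gap σ a b with hgdef
  have hδ0 : 0 ≤ δ := (opNorm_nonneg E).trans hEδ
  have hd0 := opNorm_nonneg (E - F)
  have hσab : σ b ≤ σ a := hM.antitone hab
  have hgb : g ≤ σ b := gap_le hM.nonneg a b
  have sM : IsSeparated σ a b ((σ a + σ b) / 2) ((σ a - σ b + g) / 2) (g / 2) := by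
    have := isSeparated_of_gap hM.antitone hM.nonneg (a := a) (b := b) (τ := σ) (ε := 0)
      (fun l => by rw [extendZero_coe]; simp)
    rwa [sub_zero] at this
  have hmono : ∀ {τ : Fin r → ℝ} {ε : ℝ}, ε ≤ g / 4 →
      IsSeparated τ a b ((σ a + σ b) / 2) ((σ a - σ b + g) / 2) (g / 2 - ε) →
      IsSeparated τ a b ((σ a + σ b) / 2) ((σ a - σ b + g) / 2) (g / 4) := by
    intro τ ε hε h l
    exact ⟨fun hl => by have := (h l).1 hl; linarith, fun hl => by have := (h l).2 hl; linarith⟩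
  have sE := hmono (hEδ.trans hδ) (isSeparated_of_gap hM.antitone hM.nonneg (a := a) (b := b)
    (hM.abs_sub_extendZero_le hE))
  have sF := hmono (hFδ.trans hδ) (isSeparated_of_gap hM.antitone hM.nonneg (a := a) (b := b)
    (hM.abs_sub_extendZero_le hF))
  have hsig : 0 ≤ (σ a - σ b) / g := div_nonneg (by linarith) hg.le
  refine opNorm_le_of_inner_le (by positivity) fun x c => ?_
  have hmain := hM.abs_blockForm_sub_le hσ hE hF hg (by linarith) (by linarith) hδ hEδ hFδ sM sE sF
    (complProj v x) (blockComb v c) (inner_complProj hM.orthonormal_right x)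
  rw [norm_blockComb hM.orthonormal_right] at hmain
  rw [map_sub, LinearMap.sub_apply, inner_sub_right, inner_remainder σ u hM.orthonormal_right,
    inner_remainder σ u hM.orthonormal_right]
  have hR : 0 ≤ (σ a - σ b + g) / 2 := by linarith
  have hx' := norm_complProj_le hM.orthonormal_right x
  calc _ = blockForm v₁ a b (complProj v x) (blockComb v c)
        - blockForm v₂ a b (complProj v x) (blockComb v c) - ∑ l : Block k a b,
        (σ l.1)⁻¹ * (inner ℝ (u l.1) (Matrix.toEuclideanLin (E - F) (complProj v x))
          * inner ℝ (v l.1) (blockComb v c)) := by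
        simp only [map_sub, LinearMap.sub_apply, inner_sub_right, sub_mul, mul_sub,
          Finset.sum_sub_distrib]
        ring
    _ ≤ _ := (le_abs_self _).trans hmain
    -- The radius equals `(g / 2) * (1 + (σ a - σ b) / g)`, which produces the factor of the
    -- statement and `48 = 96 / 2`.
    _ ≤ 96 * ((σ a - σ b + g) / 2) * δ * opNorm (E - F) / g ^ 3 * ‖x‖ * ‖c‖ := by gcongr
    _ = _ := by field_simp; ring

end Remainder

/-! ### From level-dependent centres to the mean -/

section MeanConcentration

variable {Ω : Type*} [MeasurableSpace Ω] {μ : Measure Ω} [IsProbabilityMeasure μ]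

/-- Layer cake formula: levels up to `L` contribute at most `L`, and `4 exp (-4 t / L)` integrates
to `L`. -/
lemma integral_abs_le_of_exp_tail {X : Ω → ℝ} (hX : Integrable X μ) {L : ℝ} (hL : 0 < L)
    (h : ∀ s : ℝ, 1 ≤ s → μ {ω | L * s < |X ω|} ≤ ENNReal.ofReal (4 * Real.exp (-(4 * s)))) :
    ∫ ω, |X ω| ∂μ ≤ 2 * L := by
  have hlc := lintegral_eq_lintegral_meas_lt μ (f := fun ω => |X ω|)
    (Filter.Eventually.of_forall fun _ => abs_nonneg _) hX.abs.aemeasurable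
  have hexp : IntegrableOn (fun t => 4 * Real.exp (-(4 / L) * t)) (Set.Ioi 0) :=
    (integrableOn_exp_mul_Ioi (by rw [neg_lt_zero]; positivity) 0).const_mul 4
  have hexpv : ∫⁻ t in Set.Ioi 0, ENNReal.ofReal (4 * Real.exp (-(4 / L) * t))
      = ENNReal.ofReal L := by
    rw [← ofReal_integral_eq_lintegral_ofReal hexp
      (Filter.Eventually.of_forall fun _ => by positivity), integral_const_mul,
      integral_exp_mul_Ioi (by rw [neg_lt_zero]; positivity)]
    congr 1
    simp
    field_simp
  have hbd : ∫⁻ t in Set.Ioi 0, μ {ω | t < |X ω|} ≤ ENNReal.ofReal (2 * L) := by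
    calc _ ≤ ∫⁻ t in Set.Ioi 0, ((Set.Ioc 0 L).indicator (fun _ => (1 : ENNReal)) t
          + ENNReal.ofReal (4 * Real.exp (-(4 / L) * t))) := by
          refine setLIntegral_mono' measurableSet_Ioi fun t ht => ?_
          by_cases htL : t ≤ L
          · rw [Set.indicator_of_mem (show t ∈ Set.Ioc 0 L from ⟨ht, htL⟩)]
            exact prob_le_one.trans le_self_add
          · refine le_trans ?_ le_add_self
            have := h (t / L) (by rw [le_div_iff₀ hL]; linarith)
            rw [mul_div_cancel₀ t hL.ne'] at this
            refine this.trans (le_of_eq ?_)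
            congr 3
            ring
      _ = ENNReal.ofReal L + ENNReal.ofReal L := by
          rw [lintegral_add_left (measurable_const.indicator measurableSet_Ioc), hexpv,
            lintegral_indicator_const measurableSet_Ioc, Measure.restrict_apply measurableSet_Ioc,
            Set.inter_eq_left.2 Set.Ioc_subset_Ioi_self, Real.volume_Ioc, sub_zero, one_mul]
      _ = _ := by rw [← ENNReal.ofReal_add hL.le hL.le]; congr 1; ring
  rw [integral_eq_lintegral_of_nonneg_ae (Filter.Eventually.of_forall fun _ => abs_nonneg _)
    hX.abs.aestronglyMeasurable, hlc]
  exact ENNReal.toReal_le_of_le_ofReal (by positivity) hbd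

/-- Concentration around varying centres implies concentration around the mean. -/
lemma concentration_around_mean {Z : Ω → ℝ} (hZ : Integrable Z μ) {K q : ℝ} (hK : 0 ≤ K)
    (hq : 1 ≤ q)
    (h : ∀ s : ℝ, 1 ≤ s → ∃ m : ℝ, μ {ω | K * Real.sqrt s * (q + Real.sqrt s) < |Z ω - m|}
      ≤ ENNReal.ofReal (4 * Real.exp (-(4 * s)))) {s : ℝ} (hs : 1 ≤ s) :
    μ {ω | 15 * K * Real.sqrt s * (q + Real.sqrt s) < |Z ω - ∫ ω', Z ω' ∂μ|}
      ≤ ENNReal.ofReal (4 * Real.exp (-(4 * s))) := by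
  set D : ℝ → ℝ := fun s => K * Real.sqrt s * (q + Real.sqrt s) with hD
  have hsq1 : ∀ s : ℝ, 1 ≤ s → 1 ≤ Real.sqrt s := fun s hs => Real.one_le_sqrt.2 hs
  obtain ⟨m, hm⟩ := h 1 le_rfl
  have hcentre : ∀ s : ℝ, 1 ≤ s → μ {ω | 3 * D s < |Z ω - m|}
      ≤ ENNReal.ofReal (4 * Real.exp (-(4 * s))) := by
    intro s hs
    obtain ⟨m', hm'⟩ := h s hs
    have hD1 : D 1 ≤ D s := by
      have := hsq1 s hs
      simp only [hD, Real.sqrt_one]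
      gcongr
    have hsmall : ∀ s : ℝ, 1 ≤ s → 4 * Real.exp (-(4 * s)) < 1 / 2 := by
      intro s hs
      have h1 : Real.exp (-(4 * s)) ≤ Real.exp (-4) := Real.exp_le_exp.2 (by linarith)
      have h2 : Real.exp (-4) < 1 / 8 := by
        rw [Real.exp_neg, ← one_div, one_div_lt_one_div (Real.exp_pos _) (by norm_num)]
        have h3 : Real.exp 4 = Real.exp 1 ^ 4 := by rw [← Real.exp_nat_mul]; norm_num
        rw [h3]
        have := Real.exp_one_gt_d9
        calc (8 : ℝ) < 2.7 ^ 4 := by norm_num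
          _ ≤ _ := by gcongr; linarith
      linarith
    -- The two exceptional events have total probability below `1`. A common good point forces `|m -
    -- m'| ≤ D 1 + D s ≤ 2 * D s`, so the single centre `m` serves every level at the price of a
    -- factor `3`.
    have hex : ∃ ω, ω ∉ {ω | D 1 < |Z ω - m|} ∪ {ω | D s < |Z ω - m'|} := by
      by_contra! hcon
      have huniv : {ω | D 1 < |Z ω - m|} ∪ {ω | D s < |Z ω - m'|} = Set.univ :=
        Set.eq_univ_of_forall hcon
      have h1 := measure_union_le (μ := μ) {ω | D 1 < |Z ω - m|} {ω | D s < |Z ω - m'|}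
      rw [huniv, measure_univ] at h1
      have h2 : (1 : ENNReal) ≤ ENNReal.ofReal
          (4 * Real.exp (-(4 * 1)) + 4 * Real.exp (-(4 * s))) := by
        rw [ENNReal.ofReal_add (by positivity) (by positivity)]
        exact h1.trans (add_le_add hm hm')
      rw [ENNReal.one_le_ofReal] at h2
      exact absurd h2 (not_le.2 ((add_lt_add (hsmall 1 le_rfl) (hsmall s hs)).trans_eq
        (by norm_num)))
    obtain ⟨ω, hω⟩ := hex
    simp only [Set.mem_union, Set.mem_ofPred_eq, not_or, not_lt] at hω
    refine (measure_mono fun ω' hω' => ?_).trans hm'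
    simp only [Set.mem_ofPred_eq] at hω' ⊢
    change D s < _
    have h1 := abs_le.1 hω.1
    have h2 := abs_le.1 hω.2
    rcases abs_cases (Z ω' - m) with ⟨h3, -⟩ | ⟨h3, -⟩
    · exact lt_of_lt_of_le (by linarith) (le_abs_self _)
    · exact lt_of_lt_of_le (by linarith) (neg_le_abs _)
  have hDle : ∀ s : ℝ, 1 ≤ s → D s ≤ 2 * (K * q) * s := by
    intro s hs
    have h1 := hsq1 s hs
    have h2 := Real.mul_self_sqrt (by linarith : 0 ≤ s)
    have h3 : Real.sqrt s ≤ s := by nlinarith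
    calc D s = K * (Real.sqrt s * q + Real.sqrt s * Real.sqrt s) := by simp only [hD]; ring
      _ ≤ K * (s * q + s * q) := by
          rw [h2]
          gcongr
          nlinarith
      _ = _ := by ring
  have hXint : Integrable (fun ω => Z ω - m) μ := hZ.sub (integrable_const m)
  have hmean : ∫ ω, |Z ω - m| ∂μ ≤ 2 * (6 * (K * q)) := by
    -- `K` may be `0`, whereas the tail lemma needs a positive scale; hence a strictly larger `L`,
    -- followed by a limit.
    have : ∀ L, 6 * (K * q) < L → ∫ ω, |Z ω - m| ∂μ ≤ 2 * L := by
      intro L hL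
      have hKq : 0 ≤ K * q := by positivity
      refine integral_abs_le_of_exp_tail hXint (by linarith) fun s hs => ?_
      refine (measure_mono fun ω hω => ?_).trans (hcentre s hs)
      simp only [Set.mem_ofPred_eq] at hω ⊢
      refine lt_of_le_of_lt ?_ hω
      have := hDle s hs
      nlinarith
    have h2 : (∫ ω, |Z ω - m| ∂μ) / 2 ≤ 6 * (K * q) :=
      le_of_forall_gt_imp_ge_of_dense fun L hL => by have := this L hL; linarith
    linarith
  have hdiff : |(∫ ω, Z ω ∂μ) - m| ≤ 12 * (K * q) := by
    have h1 : (∫ ω, Z ω ∂μ) - m = ∫ ω, (Z ω - m) ∂μ := by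
      rw [integral_sub hZ (integrable_const m), integral_const, probReal_univ, one_smul]
    rw [h1]
    refine abs_integral_le_integral_abs.trans ?_
    linarith
  refine (measure_mono fun ω hω => ?_).trans (hcentre s hs)
  simp only [Set.mem_ofPred_eq] at hω ⊢
  have hDge : K * q ≤ D s := by
    have := hsq1 s hs
    calc K * q = K * 1 * q := by ring
      _ ≤ K * Real.sqrt s * (q + Real.sqrt s) := by gcongr; linarith
  -- `15 = 3 + 12`: deviation from `m` plus the distance `12 * (K * q) ≤ 12 * D s` from `m` to the
  -- mean.
  have h15 : 15 * D s < |Z ω - ∫ ω', Z ω' ∂μ| := by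
    refine lt_of_le_of_lt (le_of_eq ?_) hω
    simp only [hD]; ring
  have htri : |Z ω - ∫ ω', Z ω' ∂μ| ≤ |Z ω - m| + |(∫ ω', Z ω' ∂μ) - m| := by
    rw [abs_sub_comm (∫ ω', Z ω' ∂μ) m]
    exact abs_sub_le _ _ _
  linarith

end MeanConcentration

/-! ### Transfer to the random matrix -/

section Assembly

open scoped NNReal

lemma matInner_sub_left {m n : Type*} [Fintype m] [Fintype n] (A B W : Matrix m n ℝ) :
    matInner (A - B) W = matInner A W - matInner B W := by
  simp [matInner, sub_mul, Finset.sum_sub_distrib]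

lemma apply_eq_inner {m n : Type*} [Fintype m] [Fintype n] [DecidableEq m] [DecidableEq n]
    (A : Matrix m n ℝ) (i : m) (j : n) : A i j = inner ℝ (EuclideanSpace.single i (1 : ℝ))
      (Matrix.toEuclideanLin A (EuclideanSpace.single j (1 : ℝ))) := by
  rw [inner_toEuclideanLin_eq_sum, Finset.sum_eq_single i, Finset.sum_eq_single j] <;>
    simp +contextual

lemma integral_matInner {Ω m n : Type*} [Fintype m] [Fintype n] [MeasurableSpace Ω]
    {μ : Measure Ω} {S : Ω → Matrix m n ℝ} (hS : ∀ i j, Integrable (fun ω => S ω i j) μ)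
    (W : Matrix m n ℝ) :
    ∫ ω, matInner (S ω) W ∂μ = matInner (Matrix.of fun i j => ∫ ω, S ω i j ∂μ) W := by
  refine (integral_finsetSum (f := fun i ω => ∑ j, S ω i j * W i j) _ fun i _ =>
    integrable_finsetSum _ fun j _ => (hS i j).mul_const _).trans ?_
  refine Finset.sum_congr rfl fun i _ => ?_
  refine (integral_finsetSum (f := fun j ω => S ω i j * W i j) _
    fun j _ => (hS i j).mul_const _).trans ?_
  exact Finset.sum_congr rfl fun j _ => integral_mul_const _ _

lemma abs_apply_le_opNorm {m n : Type*} [Fintype m] [Fintype n] [DecidableEq m] [DecidableEq n]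
    (A : Matrix m n ℝ) (i : m) (j : n) : |A i j| ≤ opNorm A := by
  have := abs_inner_toEuclideanLin_le A (EuclideanSpace.single i 1) (EuclideanSpace.single j 1)
  rw [← apply_eq_inner] at this
  simpa using this

/-- The remainder is computed from a chosen decomposition, so it need not be a function of `E`. On
the good set `G` the Lipschitz estimate at distance `0` shows that it factors through `X`; the
factor then extends from the image of `G` with the same constant. -/
lemma exists_lipschitz_factor {Ω F : Type*} [PseudoMetricSpace F] {G : Set Ω} {Z : Ω → ℝ}
    {X : Ω → F} {K : ℝ≥0} (h : ∀ ω ∈ G, ∀ ω' ∈ G, |Z ω - Z ω'| ≤ K * dist (X ω) (X ω')) :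
    ∃ f : F → ℝ, LipschitzWith K f ∧ ∀ ω ∈ G, f (X ω) = Z ω := by
  classical
  let f₀ : F → ℝ := fun x => if hx : ∃ ω ∈ G, X ω = x then Z hx.choose else 0
  have hf₀ : ∀ ω ∈ G, f₀ (X ω) = Z ω := by
    intro ω hω
    have hx : ∃ ω' ∈ G, X ω' = X ω := ⟨ω, hω, rfl⟩
    have h1 := h _ hx.choose_spec.1 ω hω
    rw [hx.choose_spec.2, dist_self, mul_zero] at h1
    simp only [f₀, dif_pos hx]
    exact sub_eq_zero.1 (abs_nonpos_iff.1 h1)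
  have hlip : LipschitzOnWith K f₀ (X '' G) := by
    apply LipschitzOnWith.of_dist_le_mul
    rintro _ ⟨ω, hω, rfl⟩ _ ⟨ω', hω', rfl⟩
    rw [hf₀ ω hω, hf₀ ω' hω', Real.dist_eq]
    exact h ω hω ω' hω'
  obtain ⟨f, hf, hfe⟩ := hlip.extend_real
  exact ⟨f, hf, fun ω hω => by rw [← hfe ⟨ω, hω, rfl⟩, hf₀ ω hω]⟩

variable {Ω : Type*} [MeasurableSpace Ω] {μ : Measure Ω} [IsProbabilityMeasure μ]

section GaussianVector

variable {F : Type*} [NormedAddCommGroup F] [InnerProductSpace ℝ F] [FiniteDimensional ℝ F]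
  [MeasurableSpace F] [BorelSpace F] {X : Ω → F}

omit [IsProbabilityMeasure μ] in
lemma upper_tail_of_hasLaw (hX : HasLaw X (stdGaussian F) μ) {f : F → ℝ} {K : ℝ≥0}
    (hf : LipschitzWith K f) {s : ℝ} (hs : 0 ≤ s) :
    μ {ω | (∫ y, f y ∂(stdGaussian F)) + 5 * K * Real.sqrt s < f (X ω)}
      ≤ ENNReal.ofReal (Real.exp (-(5 * s))) := by
  have hc := hf.continuous
  rw [hX.measure_eq (p := fun x => (∫ y, f y ∂(stdGaussian F)) + 5 * K * Real.sqrt s < f x)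
    (measurableSet_lt measurable_const hc.measurable)]
  exact stdGaussian_upper_tail hf hs

omit [IsProbabilityMeasure μ] in
lemma two_sided_tail_of_hasLaw (hX : HasLaw X (stdGaussian F) μ) {f : F → ℝ} {K : ℝ≥0}
    (hf : LipschitzWith K f) {s : ℝ} (hs : 0 ≤ s) :
    μ {ω | 5 * K * Real.sqrt s < |f (X ω) - ∫ y, f y ∂(stdGaussian F)|}
      ≤ ENNReal.ofReal (2 * Real.exp (-(5 * s))) := by
  have h1 := upper_tail_of_hasLaw hX hf hs
  have hneg : LipschitzWith K fun x => -f x := hf.neg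
  have h2 := upper_tail_of_hasLaw hX hneg hs
  rw [two_mul, ENNReal.ofReal_add (by positivity) (by positivity)]
  refine (measure_mono fun ω hω => ?_).trans ((measure_union_le _ _).trans (add_le_add h1 h2))
  simp only [Set.mem_ofPred_eq, Set.mem_union, integral_neg] at hω ⊢
  rcases lt_abs.1 hω with h | h
  · left; linarith
  · right; linarith

end GaussianVector

/-- The vector of all entries of a matrix. -/
def matrixToVec {m n : Type*} (A : Matrix m n ℝ) : EuclideanSpace ℝ (m × n) :=
  WithLp.toLp 2 fun ij => A ij.1 ij.2

lemma vecToMatrix_matrixToVec {m n : Type*} (A : Matrix m n ℝ) :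
    vecToMatrix (matrixToVec A) = A := rfl

lemma hasLaw_matrixToVec {p n : ℕ} {E : Ω → Matrix (Fin p) (Fin n) ℝ}
    (hind : iIndepFun (fun (ij : Fin p × Fin n) (ω : Ω) => E ω ij.1 ij.2) μ)
    (hlaw : ∀ i j, HasLaw (fun ω => E ω i j) (gaussianReal 0 1) μ) :
    HasLaw (fun ω => matrixToVec (E ω)) (stdGaussian (EuclideanSpace ℝ (Fin p × Fin n))) μ := by
  have hm : ∀ ij : Fin p × Fin n, AEMeasurable (fun ω => E ω ij.1 ij.2) μ :=
    fun ij => (hlaw ij.1 ij.2).aemeasurable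
  have hm' : AEMeasurable (fun ω (ij : Fin p × Fin n) => E ω ij.1 ij.2) μ :=
    aemeasurable_pi_iff.2 hm
  have h1 := (iIndepFun_iff_map_fun_eq_pi_map hm).1 hind
  have h2 : (fun ij : Fin p × Fin n => μ.map fun ω => E ω ij.1 ij.2)
      = fun _ => gaussianReal 0 1 := funext fun ij => (hlaw ij.1 ij.2).map_eq
  rw [h2] at h1
  have hme : Measurable (WithLp.toLp 2 : (Fin p × Fin n → ℝ) → EuclideanSpace ℝ (Fin p × Fin n)) :=
    by fun_prop
  refine ⟨hme.comp_aemeasurable hm', ?_⟩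
  rw [← map_pi_eq_stdGaussian, ← h1, AEMeasurable.map_map_of_aemeasurable hme.aemeasurable hm']
  rfl

omit [IsProbabilityMeasure μ] in
lemma integral_opNorm_eq {p n : ℕ} {E : Ω → Matrix (Fin p) (Fin n) ℝ}
    (hX : HasLaw (fun ω => matrixToVec (E ω)) (stdGaussian (EuclideanSpace ℝ (Fin p × Fin n))) μ) :
    ∫ ω, opNorm (E ω) ∂μ
      = ∫ x, opNorm (vecToMatrix x) ∂(stdGaussian (EuclideanSpace ℝ (Fin p × Fin n))) := by
  rw [← hX.map_eq, integral_map hX.aemeasurable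
    (lipschitzWith_opNorm_vecToMatrix.continuous.aestronglyMeasurable)]
  rfl

/-- This forces the gap to be positive under the hypothesis on the mean. If the integral vanished,
an entry would be almost surely `0`, but a nondegenerate Gaussian has no atom. -/
lemma integral_opNorm_pos {p n : ℕ} {E : Ω → Matrix (Fin p) (Fin n) ℝ}
    (hX : HasLaw (fun ω => matrixToVec (E ω)) (stdGaussian (EuclideanSpace ℝ (Fin p × Fin n))) μ)
    (i : Fin p) (j : Fin n) (hij : HasLaw (fun ω => E ω i j) (gaussianReal 0 1) μ) :
    0 < ∫ ω, opNorm (E ω) ∂μ := by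
  have hint : Integrable (fun ω => opNorm (E ω)) μ := by
    have := integrable_of_lipschitz_stdGaussian
      (lipschitzWith_opNorm_vecToMatrix (m := Fin p) (n := Fin n))
    rw [← hX.map_eq] at this
    exact this.comp_aemeasurable hX.aemeasurable
  refine lt_of_le_of_ne (integral_nonneg fun ω => opNorm_nonneg _) fun h0 => ?_
  have h1 := (integral_eq_zero_iff_of_nonneg (fun ω => opNorm_nonneg _) hint).1 h0.symm
  have h2 : ∀ᵐ ω ∂μ, E ω i j = 0 := by
    filter_upwards [h1] with ω hω
    have := abs_apply_le_opNorm (E ω) i j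
    rw [hω] at this
    exact abs_nonpos_iff.1 this
  have h3 := hij.measure_eq (p := fun x => x = 0) (measurableSet_singleton 0)
  have := nullSingletonClass_gaussianReal (μ := 0) (v := 1) one_ne_zero
  rw [show {x : ℝ | x = 0} = {0} from rfl, measure_singleton] at h3
  have h4 : ∀ᵐ ω ∂μ, ¬ E ω i j = 0 := by
    rw [ae_iff]
    simpa using h3
  obtain ⟨ω, h5, h6⟩ := (h2.and h4).exists
  exact h6 h5

variable {p n k r : ℕ} {M : Matrix (Fin p) (Fin n) ℝ} {σ : Fin k → ℝ}
  {u : Fin k → EuclideanSpace ℝ (Fin p)} {v : Fin k → EuclideanSpace ℝ (Fin n)}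
  {E : Ω → Matrix (Fin p) (Fin n) ℝ} {τ : Ω → Fin r → ℝ}
  {u' : Ω → Fin r → EuclideanSpace ℝ (Fin p)} {v' : Ω → Fin r → EuclideanSpace ℝ (Fin n)}

/-- In bilinear form, the projection part is bounded because the `v' ω j` are unit vectors, and the
linear part is a finite combination of Gaussian entries. -/
lemma integrable_remainder (hM : IsSVD M σ u v) (a b : Fin k)
    (hlaw : ∀ i j, HasLaw (fun ω => E ω i j) (gaussianReal 0 1) μ)
    (hv' : ∀ᵐ ω ∂μ, Orthonormal ℝ (v' ω)) (hmeas : ∀ j, AEMeasurable (fun ω => v' ω j) μ)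
    (i : Fin n) (j : Block k a b) :
    Integrable (fun ω => remainder σ u v a b (E ω) (v' ω) i j) μ := by
  have hEint : ∀ i j, Integrable (fun ω => E ω i j) μ := by
    intro i j
    have : Integrable (fun x : ℝ => x) (gaussianReal 0 1) := IsGaussian.integrable_id
    rw [← (hlaw i j).map_eq] at this
    exact this.comp_aemeasurable (hlaw i j).aemeasurable
  have hentry : ∀ ω, remainder σ u v a b (E ω) (v' ω) i j
      = inner ℝ (EuclideanSpace.single i 1) (Matrix.toEuclideanLin
        (remainder σ u v a b (E ω) (v' ω)) (EuclideanSpace.single j 1)) := by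
    exact fun ω => apply_eq_inner _ i j
  simp only [hentry, inner_remainder σ u hM.orthonormal_right, blockForm,
    inner_toEuclideanLin_eq_sum (E _)]
  refine Integrable.sub ?_ ?_
  · refine integrable_finsetSum _ fun l _ => ?_
    set x := complProj v (EuclideanSpace.single i 1)
    set y := blockComb v (EuclideanSpace.single j (1 : ℝ))
    have hm := hmeas l.1
    refine Integrable.of_bound (C := ‖x‖ * ‖y‖) ?_ ?_
    · exact ((hm.inner aemeasurable_const).mul (hm.inner aemeasurable_const)).aestronglyMeasurable
    · filter_upwards [hv'] with ω hω
      rw [norm_mul]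
      have h1 : ∀ x, ‖(inner ℝ (v' ω l.1) x : ℝ)‖ ≤ ‖x‖ := fun x => by
        have := norm_inner_le_norm (𝕜 := ℝ) (v' ω l.1) x
        rwa [hω.1, one_mul] at this
      exact mul_le_mul (h1 x) (h1 y) (norm_nonneg _) (norm_nonneg _)
  · refine integrable_finsetSum _ fun l _ => Integrable.const_mul (Integrable.mul_const ?_ _) _
    exact integrable_finsetSum _ fun i _ => integrable_finsetSum _ fun j _ =>
      ((hEint i j).const_mul _).mul_const _

omit [IsProbabilityMeasure μ] in
/-- For every level `s`, concentration of a linear form of the remainder around some centre. -/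
lemma exists_centre_remainder (hM : IsSVD M σ u v) (hσ : ∀ j, 0 < σ j) {a b : Fin k} (hab : a ≤ b)
    (hg : 0 < gap σ a b)
    (hX : HasLaw (fun ω => matrixToVec (E ω)) (stdGaussian (EuclideanSpace ℝ (Fin p × Fin n))) μ)
    (hsvd : ∀ᵐ ω ∂μ, IsSVD (M + E ω) (τ ω) (u' ω) (v' ω))
    (hmean : (∫ ω, opNorm (E ω) ∂μ) ≤ gap σ a b / 8)
    (W : Matrix (Fin n) (Block k a b) ℝ) {s : ℝ} (hs : 1 ≤ s) :
    ∃ m : ℝ, μ {ω | 3400 * (1 + (σ a - σ b) / gap σ a b) / gap σ a b ^ 2 * nuclearNorm W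
        * Real.sqrt s * (Real.sqrt ((n : ℝ) + p) + Real.sqrt s)
          < |matInner (remainder σ u v a b (E ω) (v' ω)) W - m|}
      ≤ ENNReal.ofReal (4 * Real.exp (-(4 * s))) := by
  have hk : k ≤ min p n := hM.card_le
  have hn : 0 < n := by have := a.isLt; omega
  have : Nonempty (Fin n) := ⟨⟨0, hn⟩⟩
  set g := gap σ a b with hgdef
  set A := 1 + (σ a - σ b) / g with hA
  set q := Real.sqrt ((n : ℝ) + p) with hq
  set e := ∫ ω, opNorm (E ω) ∂μ with he
  set N := nuclearNorm W with hN
  have hN0 : 0 ≤ N := nuclearNorm_nonneg W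
  have hA1 : 1 ≤ A := by
    have : σ b ≤ σ a := hM.antitone hab
    have : 0 ≤ (σ a - σ b) / g := div_nonneg (by linarith) hg.le
    linarith
  have hq0 : 0 ≤ q := Real.sqrt_nonneg _
  have hs1 : 1 ≤ Real.sqrt s := Real.one_le_sqrt.2 hs
  have he0 : 0 ≤ e := integral_nonneg fun ω => opNorm_nonneg _
  have heq : e ≤ 12 * q := by
    rw [he, integral_opNorm_eq hX]
    have := integral_opNorm_stdGaussian_le (m := Fin p) (n := Fin n)
    simpa using this
  have hexp : Real.exp (-(5 * s)) ≤ Real.exp (-(4 * s)) := Real.exp_le_exp.2 (by linarith)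
  -- The operator norm is `1`-Lipschitz in the entries, so this is its upper deviation level with
  -- probability `exp (-5 s)`.
  set δ := e + 5 * Real.sqrt s with hδ
  have hbad : μ {ω | ¬ (IsSVD (M + E ω) (τ ω) (u' ω) (v' ω) ∧ opNorm (E ω) ≤ δ)}
      ≤ ENNReal.ofReal (Real.exp (-(5 * s))) := by
    have h1 := upper_tail_of_hasLaw hX (lipschitzWith_opNorm_vecToMatrix (m := Fin p) (n := Fin n))
      (by linarith : 0 ≤ s)
    rw [← integral_opNorm_eq hX] at h1
    simp only [vecToMatrix_matrixToVec, NNReal.coe_one, mul_one] at h1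
    calc _ ≤ μ ({ω | ¬ IsSVD (M + E ω) (τ ω) (u' ω) (v' ω)} ∪
            {ω | e + 5 * Real.sqrt s < opNorm (E ω)}) := by
          refine measure_mono fun ω hω => ?_
          simp only [Set.mem_ofPred_eq, Set.mem_union, not_and_or, not_le] at hω ⊢
          exact hω
      _ ≤ _ := (measure_union_le _ _).trans (by
          rw [ae_iff.1 hsvd, zero_add]
          exact h1)
  -- In the first case `δ ≤ g / 8 + g / 8 = g / 4` and the Lipschitz bound is available. In the
  -- second `g < 40 √s`, and the deterministic bound suffices with centre `0`.
  by_cases hcase : 5 * Real.sqrt s ≤ g / 8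
  · have hδg : δ ≤ g / 4 := by linarith
    have hL0 : 0 ≤ 48 * A * δ / g ^ 2 * N := by positivity
    set L : ℝ≥0 := (48 * A * δ / g ^ 2 * N).toNNReal with hL
    have hLc : (L : ℝ) = 48 * A * δ / g ^ 2 * N := Real.coe_toNNReal _ hL0
    obtain ⟨f, hf, hfe⟩ := exists_lipschitz_factor
      (G := {ω | IsSVD (M + E ω) (τ ω) (u' ω) (v' ω) ∧ opNorm (E ω) ≤ δ})
      (Z := fun ω => matInner (remainder σ u v a b (E ω) (v' ω)) W)
      (X := fun ω => matrixToVec (E ω)) (K := L) (by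
        intro ω hω ω' hω'
        rw [← matInner_sub_left, hLc]
        have h1 := opNorm_remainder_sub_le hM hσ hab hg hω.1 hω'.1 hδg hω.2 hω'.2
        have h2 := opNorm_vecToMatrix_le (matrixToVec (E ω) - matrixToVec (E ω'))
        rw [vecToMatrix_sub, vecToMatrix_matrixToVec, vecToMatrix_matrixToVec,
          ← dist_eq_norm] at h2
        calc _ ≤ _ := abs_matInner_le _ _
          _ ≤ (48 * A * δ / g ^ 2 * opNorm (E ω - E ω')) * N := by gcongr
          _ ≤ (48 * A * δ / g ^ 2 * dist (matrixToVec (E ω)) (matrixToVec (E ω'))) * N := by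
              gcongr
          _ = _ := by ring)
    refine ⟨∫ y, f y ∂(stdGaussian (EuclideanSpace ℝ (Fin p × Fin n))), ?_⟩
    have htail := two_sided_tail_of_hasLaw hX hf (by linarith : 0 ≤ s)
    calc _ ≤ μ ({ω | ¬ (IsSVD (M + E ω) (τ ω) (u' ω) (v' ω) ∧ opNorm (E ω) ≤ δ)} ∪
          {ω | 5 * L * Real.sqrt s < |f (matrixToVec (E ω))
            - ∫ y, f y ∂(stdGaussian (EuclideanSpace ℝ (Fin p × Fin n)))|}) := by
          refine measure_mono fun ω hω => ?_
          by_cases hG : IsSVD (M + E ω) (τ ω) (u' ω) (v' ω) ∧ opNorm (E ω) ≤ δ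
          · right
            simp only [Set.mem_ofPred_eq] at hω ⊢
            rw [hfe ω hG]
            refine lt_of_le_of_lt ?_ hω
            rw [hLc]
            -- From `δ ≤ 12 q + 5 √s`: `240 * 12 = 2880` and `240 * 5 = 1200` are both at most
            -- `3400`.
            have hδq : 5 * (48 * δ) ≤ 3400 * (q + Real.sqrt s) := by linarith
            calc 5 * (48 * A * δ / g ^ 2 * N) * Real.sqrt s
                = (5 * (48 * δ)) * (A / g ^ 2 * N * Real.sqrt s) := by ring
              _ ≤ (3400 * (q + Real.sqrt s)) * (A / g ^ 2 * N * Real.sqrt s) := by gcongr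
              _ = _ := by ring
          · left; exact hG
      _ ≤ ENNReal.ofReal (Real.exp (-(5 * s))) + ENNReal.ofReal (2 * Real.exp (-(5 * s))) :=
          (measure_union_le _ _).trans (add_le_add hbad htail)
      _ ≤ _ := by
          rw [← ENNReal.ofReal_add (by positivity) (by positivity)]
          apply ENNReal.ofReal_le_ofReal
          have := Real.exp_pos (-(5 * s))
          linarith
  · rw [not_le] at hcase
    refine ⟨0, (measure_mono fun ω hω hG => ?_).trans (hbad.trans (ENNReal.ofReal_le_ofReal ?_))⟩
    · simp only [Set.mem_ofPred_eq, sub_zero] at hω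
      refine absurd hω (not_lt.2 ?_)
      have h1 : opNorm (remainder σ u v a b (E ω) (v' ω)) ≤ 1 + opNorm (E ω) / g :=
        opNorm_remainder_le hM hg hG.1.orthonormal_right
      have hgs : g < 40 * Real.sqrt s := by linarith
      -- With `g < 40 √s` and `opNorm (E ω) ≤ g / 8 + 5 √s`, the product `g * (g + opNorm (E ω))` is
      -- at most `40 * (40 + 5 + 5) * s = 2000 s`.
      have h2 : 1 + opNorm (E ω) / g ≤ 3400 * s / g ^ 2 := by
        have hss := Real.mul_self_sqrt (by linarith : 0 ≤ s)
        rw [le_div_iff₀ (by positivity)]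
        have h3 : opNorm (E ω) ≤ g / 8 + 5 * Real.sqrt s := hG.2.trans (by linarith)
        calc (1 + opNorm (E ω) / g) * g ^ 2 = g * (g + opNorm (E ω)) := by field_simp
          _ ≤ (40 * Real.sqrt s) * (40 * Real.sqrt s + (40 * Real.sqrt s / 8 + 5 * Real.sqrt s)) := by
              have := opNorm_nonneg (E ω)
              gcongr
              linarith
          _ = 2000 * (Real.sqrt s * Real.sqrt s) := by ring
          _ ≤ _ := by rw [hss]; linarith
      calc _ ≤ _ := abs_matInner_le _ _
        _ ≤ (3400 * s / g ^ 2) * N := by gcongr; exact h1.trans h2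
        _ = 3400 * 1 / g ^ 2 * N * Real.sqrt s * Real.sqrt s := by
            have hss := Real.mul_self_sqrt (by linarith : 0 ≤ s)
            rw [mul_assoc _ (Real.sqrt s), hss]; ring
        _ ≤ _ := by gcongr; linarith
    · have := Real.exp_pos (-(4 * s))
      linarith

end Assembly

end SpectralPert

/-! ### The theorem -/

theorem lemma4p3 :
    ∃ C : ℝ, 0 < C ∧
      ∀ {p n k : ℕ} (M : Matrix (Fin p) (Fin n) ℝ) (σ : Fin k → ℝ)
        (u : Fin k → EuclideanSpace ℝ (Fin p)) (v : Fin k → EuclideanSpace ℝ (Fin n)),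
        SpectralPert.IsSVD M σ u v → (∀ j, 0 < σ j) →
      ∀ (a b : Fin k), a ≤ b →
      ∀ {Ω : Type*} [MeasurableSpace Ω] (μ : Measure Ω) [IsProbabilityMeasure μ]
        (E : Ω → Matrix (Fin p) (Fin n) ℝ),
        iIndepFun (fun (ij : Fin p × Fin n) (ω : Ω) => E ω ij.1 ij.2) μ →
        (∀ i j, HasLaw (fun ω => E ω i j) (gaussianReal 0 1) μ) →
      ∀ (σ' : Ω → Fin (min p n) → ℝ)
        (u' : Ω → Fin (min p n) → EuclideanSpace ℝ (Fin p))
        (v' : Ω → Fin (min p n) → EuclideanSpace ℝ (Fin n)),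
        (∀ᵐ ω ∂μ, SpectralPert.IsSVD (M + E ω) (σ' ω) (u' ω) (v' ω)) →
        (∀ j, AEMeasurable (fun ω => v' ω j) μ) →
        (∫ ω, SpectralPert.opNorm (E ω) ∂μ) ≤ SpectralPert.gap σ a b / 8 →
        (∀ i j, Integrable (fun ω => SpectralPert.remainder σ u v a b (E ω) (v' ω) i j) μ) ∧
        ∀ (W : Matrix (Fin n) (SpectralPert.Block k a b) ℝ) (t : ℝ), Real.log 4 ≤ t →
          1 - 2 * Real.exp (-t) ≤
            μ.real {ω |
              |SpectralPert.matInner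
                  (SpectralPert.remainder σ u v a b (E ω) (v' ω)
                    - Matrix.of fun i j =>
                        ∫ ω', SpectralPert.remainder σ u v a b (E ω') (v' ω') i j ∂μ) W|
                ≤ C * (1 + (σ a - σ b) / SpectralPert.gap σ a b)
                    * (Real.sqrt t / SpectralPert.gap σ a b)
                    * ((Real.sqrt ((n : ℝ) + (p : ℝ)) + Real.sqrt t) / SpectralPert.gap σ a b)
                    * SpectralPert.nuclearNorm W} := by
  -- `51000 = 15 * 3400`: the loss in passing to the mean times the constant of
  -- `exists_centre_remainder`.
  refine ⟨51000, by norm_num, ?_⟩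
  intro p n k M σ u v hM hσ a b hab Ω _ μ _ E hind hlaw σ' u' v' hsvd hmeas hmean
  have hk : k ≤ min p n := hM.card_le
  have hp : 0 < p := by have := a.isLt; omega
  have hn : 0 < n := by have := a.isLt; omega
  have hX := SpectralPert.hasLaw_matrixToVec hind hlaw
  -- Positivity of the gap is not assumed; it follows from `0 < 𝔼 opNorm E ≤ gap / 8`.
  have hg : 0 < SpectralPert.gap σ a b := by
    have := SpectralPert.integral_opNorm_pos hX ⟨0, hp⟩ ⟨0, hn⟩ (hlaw _ _)
    linarith
  have hint : ∀ i j, Integrable (fun ω => SpectralPert.remainder σ u v a b (E ω) (v' ω) i j) μ :=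
    SpectralPert.integrable_remainder hM a b hlaw (hsvd.mono fun ω h => h.orthonormal_right) hmeas
  refine ⟨hint, fun W t ht => ?_⟩
  have ht1 : 1 ≤ t := by
    refine le_trans ?_ ht
    rw [Real.le_log_iff_exp_le (by norm_num)]
    linarith [Real.exp_one_lt_d9]
  set Z : Ω → ℝ := fun ω =>
    SpectralPert.matInner (SpectralPert.remainder σ u v a b (E ω) (v' ω)) W with hZ
  have hZint : Integrable Z μ :=
    integrable_finsetSum _ fun i _ => integrable_finsetSum _ fun j _ => (hint i j).mul_const _
  have hZmean : ∫ ω, Z ω ∂μ = SpectralPert.matInner (Matrix.of fun i j =>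
      ∫ ω', SpectralPert.remainder σ u v a b (E ω') (v' ω') i j ∂μ) W :=
    SpectralPert.integral_matInner hint W
  have hsig : 0 ≤ (σ a - σ b) / SpectralPert.gap σ a b :=
    div_nonneg (by linarith [hM.antitone hab]) hg.le
  have hq : 1 ≤ Real.sqrt ((n : ℝ) + p) := by
    rw [Real.one_le_sqrt]
    have : (1 : ℝ) ≤ n := by exact_mod_cast hn
    have : (0 : ℝ) ≤ p := by positivity
    linarith
  have hmain := SpectralPert.concentration_around_mean hZint
    (K := 3400 * (1 + (σ a - σ b) / SpectralPert.gap σ a b) / SpectralPert.gap σ a b ^ 2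
      * SpectralPert.nuclearNorm W)
    (by have := SpectralPert.nuclearNorm_nonneg W; positivity) hq
    (fun s hs => SpectralPert.exists_centre_remainder hM hσ hab hg hX hsvd hmean W hs) ht1
  set S := {ω | |SpectralPert.matInner
    (SpectralPert.remainder σ u v a b (E ω) (v' ω)
      - Matrix.of fun i j =>
          ∫ ω', SpectralPert.remainder σ u v a b (E ω') (v' ω') i j ∂μ) W|
      ≤ 51000 * (1 + (σ a - σ b) / SpectralPert.gap σ a b)
      * (Real.sqrt t / SpectralPert.gap σ a b)
      * ((Real.sqrt ((n : ℝ) + (p : ℝ)) + Real.sqrt t) / SpectralPert.gap σ a b)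
      * SpectralPert.nuclearNorm W} with hS
  have hcompl : μ Sᶜ ≤ ENNReal.ofReal (4 * Real.exp (-(4 * t))) := by
    refine (measure_mono fun ω hω => ?_).trans hmain
    simp only [hS, Set.mem_compl_iff, Set.mem_ofPred_eq, not_le,
      SpectralPert.matInner_sub_left] at hω ⊢
    rw [hZmean]
    refine lt_of_le_of_lt (le_of_eq ?_) hω
    field_simp
    ring
  have hfinal : 4 * Real.exp (-(4 * t)) ≤ 2 * Real.exp (-t) := by
    have h1 : Real.exp (-(4 * t)) = Real.exp (-(3 * t)) * Real.exp (-t) := by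
      rw [← Real.exp_add]; congr 1; ring
    have h2 : Real.exp (-(3 * t)) ≤ 1 / 2 := by
      have h3 := Real.add_one_le_exp (3 * t)
      rw [Real.exp_neg, ← one_div]
      apply one_div_le_one_div_of_le <;> linarith
    rw [h1]
    nlinarith [Real.exp_pos (-t)]
  have hreal : μ.real Sᶜ ≤ 2 * Real.exp (-t) :=
    (ENNReal.toReal_le_of_le_ofReal (by positivity) hcompl).trans hfinal
  -- Subadditivity replaces the complement rule, since `S` is not known to be measurable.
  have hunion : (1 : ℝ) ≤ μ.real S + μ.real Sᶜ := by
    have := measureReal_union_le (μ := μ) S Sᶜ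
    rwa [Set.union_compl_self, probReal_univ] at this
  linarith
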